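/- Throughout, $\log$ is the logarithm to base two and $\Sigma=\{0,1\}$. **Notation.** For $x=x_1\cdots x_n\in\Sigma^n$, let $\mathcal B(x)\subseteq\Sigma^{n-1}$ be the set of all sequences obtained from $x$ by deleting exactly one symbol and then changing at most one symbol. A code $\mathcal C\subseteq\Sigma^n$ is an $(n,N;\mathcal B)$-reconstruction code if $|\mathcal B(x)\cap\mathcal B(y)|<N$ for all distinct $x,y\in\mathcal C$; its redundancy is $\mathrm{red}(\mathcal C)=n-\log|\mathcal C|$. Put $\mathrm{wt}(x)=\sum_i x_i$, $\mathrm{VT}^0(x)=\mathrm{wt}(x)$ and $\mathrm{VT}^k(x)=\sum_{i=1}^n\sum_{j=1}^i j^{k-1}x_i$ for $k\ge1$. With $x_0=x_{n+1}=0$, the differential sequence $\psi(x)\in\Sigma^{n+1}$ has entries $\psi(x)_i\equiv x_i-x_{i-1}\pmod 2$, $1\le i\le n+1$. A sequence is strong-$(l,\epsilon)$-locally-balanced if each of its substrings (of consecutive symbols) of length $l'\ge l$ has weight between $(\frac12-\epsilon)l'$ and $(\frac12+\epsilon)l'$. The period of a sequence $u$ is the least $p\ge 1$ with $u_i=u_{i+p}$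 for all $1\le i\le |u|-p$; $\mathcal R(n,t',t)$ is the set of $x\in\Sigma^n$ all of whose substrings of period at most $t'$ have length at most $t$. For a positive integer $P$, cut $x\in\Sigma^n$ into consecutive blocks $x^{(P,1)},x^{(P,2)},\dots$ of length $P$, the block with index $\lfloor n/P\rfloor+1$ being the (possibly empty) remainder and all later blocks being empty. **Theorem.** Let $n\ge10$, $\epsilon=\frac1{18}$, $l=\lceil1296\log n\rceil$, $P=4l$, $t=\lceil\log n\rceil+3$, and let $\mathcal M$ be the set of $x\in\Sigma^n$ such that $x$ and $\psi(x)$ are both strong-$(l,\epsilon)$-locally-balanced. For integers $s_0\in[0,3]$, $s_1\in[0,3n]$, $h_0\in[0,6]$, $h_1\in[0,6(n+1)]$ and $g_k,g_k'\in[0,3(2P)^k-1]$ for $k\in\{1,2,3\}$, let $\mathcal C(n,9,\mathcal B)$ be the set of all $x\in\Sigma^n$ such that - $x\in\mathcal M\cap\mathcal R(n,2,t)$; - $\mathrm{VT}^0(x)\equiv s_0\pmod 4$ and $\mathrm{VT}^1(x)\equiv s_1\pmod{3n+1}$; - $\mathrm{VT}^0(\psi(x))\equiv h_0\pmod 7$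 and $\mathrm{VT}^1(\psi(x))\equiv h_1\pmod{6(n+1)+1}$; - $\sum_{i\ge1}\mathrm{VT}^k\big(x^{(P,2i-1)}x^{(P,2i)}\big)\equiv g_k\pmod{3(2P)^k}$ for $k\in\{1,2,3\}$; - $\sum_{i\ge1}\mathrm{VT}^k\big(x^{(P,2i)}x^{(P,2i+1)}\big)\equiv g_k'\pmod{3(2P)^k}$ for $k\in\{1,2,3\}$. Then, for every choice of these integers, $\mathcal C(n,9,\mathcal B)$ is an $(n,9;\mathcal B)$-reconstruction code. Moreover, there is an absolute constant $K$ such that for every $n\ge10$ the integers $s_0,s_1,h_0,h_1,g_k,g_k'$ can be chosen in the above ranges so that $\mathcal C(n,9,\mathcal B)$ is nonempty and $$\mathrm{red}(\mathcal C(n,9,\mathcal B))\le 2\log n+12\log\log n+K.$$ -/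

import Mathlib

/-! Binary sequences are lists of Booleans (`true` is `1`); `Σ^n` is the set of lists of length `n`. -/

namespace DelSub

/-- The number of ones of a sequence. -/
def wt (x : List Bool) : ℕ := x.count true

/-- The number of coordinates where two sequences (of equal length) differ. -/
def hamming (x y : List Bool) : ℕ := (x.zip y).countP (fun p => p.1 != p.2)

/-- The single-deletion ball: the subsequences that are shorter by one. -/
def delBall (x : List Bool) : Set (List Bool) :=
  {y | y.length + 1 = x.length ∧ List.Sublist y x}

/-- The single-substitution ball: the sequences of the same length at Hamming distance at most one. -/
def subBall (x : List Bool) : Set (List Bool) :=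
  {y | y.length = x.length ∧ hamming x y ≤ 1}

/-- The single-deletion single-substitution ball. -/
def ball (x : List Bool) : Set (List Bool) :=
  {z | ∃ w ∈ delBall x, z ∈ subBall w}

/-- `(n, N; ball)`-reconstruction codes. -/
def IsReconstructionCode (n N : ℕ) (C : Set (List Bool)) : Prop :=
  (∀ x ∈ C, x.length = n) ∧
    ∀ x ∈ C, ∀ y ∈ C, x ≠ y → (ball x ∩ ball y).encard < N

/-- The redundancy `n - log₂ |C|` of a code `C ⊆ Σ^n`. -/
noncomputable def redundancy (n : ℕ) (C : Set (List Bool)) : ℝ :=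
  (n : ℝ) - Real.logb 2 (C.ncard : ℝ)

/-- The `k`-th order VT syndrome. The index `i` starts at `0`, so that `x.getD i false` is the
`(i+1)`-st entry, with coefficient `1 ^ (k-1) + ⋯ + (i+1) ^ (k-1)` for `k ≥ 1`. -/
def VT : ℕ → List Bool → ℕ
  | 0, x => wt x
  | k + 1, x => ∑ i ∈ Finset.range x.length,
      ∑ j ∈ Finset.Icc 1 (i + 1), j ^ k * (x.getD i false).toNat

/-- The differential sequence `(x_i - x_{i-1} mod 2)` for `1 ≤ i ≤ n + 1`,
where `x_0 = x_{n+1} = 0`. -/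
def diffSeq (x : List Bool) : List Bool :=
  List.zipWith Bool.xor (x ++ [false]) (false :: x)

/-- Strong `(l, ε)`-locally balanced: every substring of length `l' ≥ l` has weight between
`(1/2 - ε) l'` and `(1/2 + ε) l'`. -/
def StrongLocallyBalanced (l : ℕ) (ε : ℝ) (x : List Bool) : Prop :=
  ∀ i l' : ℕ, l ≤ l' → i + l' ≤ x.length →
    (1 / 2 - ε) * (l' : ℝ) ≤ (wt ((x.drop i).take l') : ℝ) ∧
      (wt ((x.drop i).take l') : ℝ) ≤ (1 / 2 + ε) * (l' : ℝ)

/-- `u` has period `p`: `p` is the smallest positive shift that preserves the entries. -/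
def HasPeriod (u : List Bool) (p : ℕ) : Prop :=
  IsLeast {q : ℕ | 0 < q ∧ ∀ i, i + q < u.length → u[i]? = u[i + q]?} p

/-- The sequences of length `n` all of whose substrings of period at most `t'` have
length at most `t`. -/
def boundedPeriodic (n t' t : ℕ) : Set (List Bool) :=
  {x | x.length = n ∧ ∀ u, List.IsInfix u x → (∃ p ≤ t', HasPeriod u p) → u.length ≤ t}

/-- The `i`-th block (`i ≥ 1`) of length `P` of `x`; the last nonempty one may be shorter, and all
later ones are empty. -/
def block (P : ℕ) (x : List Bool) (i : ℕ) : List Bool :=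
  (x.drop ((i - 1) * P)).take P

/-- The sum of the syndromes of the pairs of blocks `(1,2), (3,4), …`. -/
def oddPairVT (P k : ℕ) (x : List Bool) : ℕ :=
  ∑ i ∈ Finset.Icc 1 (x.length / P + 1), VT k (block P x (2 * i - 1) ++ block P x (2 * i))

/-- The sum of the syndromes of the pairs of blocks `(2,3), (4,5), …`. -/
def evenPairVT (P k : ℕ) (x : List Bool) : ℕ :=
  ∑ i ∈ Finset.Icc 1 (x.length / P + 1), VT k (block P x (2 * i) ++ block P x (2 * i + 1))

/-- The window length `l = ⌈1296 log₂ n⌉`. -/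
noncomputable def winLen (n : ℕ) : ℕ := ⌈1296 * Real.logb 2 (n : ℝ)⌉₊

/-- The block length `P = 4 l`. -/
noncomputable def blockLen (n : ℕ) : ℕ := 4 * winLen n

/-- The sequences `x` of length `n` such that `x` and its differential sequence are
strong `(l, 1/18)`-locally balanced. -/
def balancedSet (n : ℕ) : Set (List Bool) :=
  {x | x.length = n ∧ StrongLocallyBalanced (winLen n) (1 / 18) x ∧
    StrongLocallyBalanced (winLen n) (1 / 18) (diffSeq x)}

/-- The residues that define one code. Here `g k` and `g' k`, for `k : Fin 3`, are the residues
of the block constraints of order `k + 1`. -/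
structure Params where
  s₀ : ℕ
  s₁ : ℕ
  h₀ : ℕ
  h₁ : ℕ
  g : Fin 3 → ℕ
  g' : Fin 3 → ℕ

/-- The residues lie in their ranges. -/
def Params.InRange (n : ℕ) (p : Params) : Prop :=
  p.s₀ ≤ 3 ∧ p.s₁ ≤ 3 * n ∧ p.h₀ ≤ 6 ∧ p.h₁ ≤ 6 * (n + 1) ∧
    ∀ k : Fin 3, p.g k < 3 * (2 * blockLen n) ^ (k.val + 1) ∧
      p.g' k < 3 * (2 * blockLen n) ^ (k.val + 1)

/-- The code `C(n, 9, ball)` with the given residues, where `t = ⌈log₂ n⌉ + 3`. -/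
def code (n : ℕ) (p : Params) : Set (List Bool) :=
  {x | x ∈ balancedSet n ∧
    x ∈ boundedPeriodic n 2 (⌈Real.logb 2 (n : ℝ)⌉₊ + 3) ∧
    VT 0 x ≡ p.s₀ [MOD 4] ∧
    VT 1 x ≡ p.s₁ [MOD 3 * n + 1] ∧
    VT 0 (diffSeq x) ≡ p.h₀ [MOD 7] ∧
    VT 1 (diffSeq x) ≡ p.h₁ [MOD 6 * (n + 1) + 1] ∧
    ∀ k : Fin 3,
      oddPairVT (blockLen n) (k.val + 1) x ≡ p.g k [MOD 3 * (2 * blockLen n) ^ (k.val + 1)] ∧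
      evenPairVT (blockLen n) (k.val + 1) x ≡ p.g' k [MOD 3 * (2 * blockLen n) ^ (k.val + 1)]}

end DelSub

/-! A common element `z` of the balls of `x` and `y` is within one substitution of `x` without an
entry `d` and of `y` without an entry `d'`. These two punctured words therefore differ in at most
two positions `e < f`, by `σ` and `τ`; this is a `Sol`. The bound 8 is 4 times 2: up to equality of
the punctured words there are at most four pairs `(d, d')`, the two punctured words of a pair are
distinct, and two distinct words have at most two common neighbours at Hamming distance at most one.

A `Sol` forces the suffix sums of `x` and `y` to differ by at most 3, and those of their changes by
at most 6, so the global congruences become equalities. The suffix-sum difference `D` changes sign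
at most twice (`Sol.exists_signs`). If all differences of `x` and `y` lie within two adjacent
blocks, one family of block syndromes makes the moments of `D` of orders 0, 1, 2 vanish. Pairing `D`
with a quadratic that has the same sign pattern gives `D = 0`, hence `x = y` (`Sol.eq_of_local`). So
distinct codewords with a common neighbour differ at two places at least `4 l` apart (`FarPair`).

For such a pair, the first moments of the words and of their changes, together with local balance,
imply that both substitutions occur, cancel, and lie at least `l / 10` from both deletions
(`Sol.good`). Between `d` and `d'` one word is the other shifted by one. Two different alignments of
the same stretch would create a long window of period one or two, which is forbidden. Hence a long
shift determines the punctured words. When all shifts are short, the differences form two distant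
clusters, one from the shift and one from the substitutions; the cluster of the shift and its
direction leave four possibilities (`FarPair.exists_four`).

For the redundancy, a Chernoff bound and union bounds show that at least half of all words satisfy
the constraints without residues. The residue tuples number `O(n ^ 2 * (log n) ^ 12)`, so some tuple
keeps a sufficiently large code by the pigeonhole principle. -/

namespace DelSub

/-! ### Words as integer sequences, and syndromes as sums of suffix sums -/

/-- The entries of `x`, indexed from `1`, as integers; all other entries are `0`. -/
def seq (x : List Bool) (i : ℕ) : ℤ := if (false :: x).getD i false then 1 else 0

/-- Deletion of the entry `d`. -/
def del (A : ℕ → ℤ) (d i : ℕ) : ℤ := if i < d then A i else A (i + 1)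

/-- The indicator of a change between the entries `i` and `i + 1`. -/
def chg (A : ℕ → ℤ) (i : ℕ) : ℤ := |A i - A (i + 1)|

/-- Suffix sums. -/
def suf (N : ℕ) (a : ℕ → ℤ) (j : ℕ) : ℤ := ∑ i ∈ Finset.Ico j N, a i

/-- First moments. -/
def mom (N : ℕ) (a : ℕ → ℤ) : ℤ := ∑ i ∈ Finset.range N, (i : ℤ) * a i

/-- `A` is a `0`-`1` sequence that vanishes outside `[1, n]`. -/
structure IsWord (n : ℕ) (A : ℕ → ℤ) : Prop where
  bit : ∀ i, A i = 0 ∨ A i = 1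
  zero : A 0 = 0
  supp : ∀ i, n < i → A i = 0

theorem isWord_seq (x : List Bool) : IsWord x.length (seq x) := by
  refine ⟨fun i => ?_, by simp [seq], fun i hi => ?_⟩
  · unfold seq; split <;> simp
  · unfold seq
    rw [List.getD_eq_default _ _ (by simpa using hi)]
    simp

theorem seq_succ (x : List Bool) (i : ℕ) : seq x (i + 1) = if x.getD i false then 1 else 0 := by
  simp [seq]

theorem seq_succ_toNat (x : List Bool) (i : ℕ) : ((x.getD i false).toNat : ℤ) = seq x (i + 1) := by
  rw [seq_succ]; cases x.getD i false <;> simp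

theorem seq_injective {x y : List Bool} (h : x.length = y.length) (hxy : seq x = seq y) :
    x = y := by
  refine List.ext_getElem h fun i h1 h2 => ?_
  have := congrFun hxy (i + 1)
  rw [seq_succ, seq_succ, List.getD_eq_getElem _ _ h1, List.getD_eq_getElem _ _ h2] at this
  cases hx : x[i] <;> cases hy : y[i] <;> simp_all

theorem seq_eraseIdx (x : List Bool) {k : ℕ} :
    seq (x.eraseIdx k) = del (seq x) (k + 1) := by
  funext i
  rcases i with _ | i
  · simp [seq, del]
  · simp only [seq_succ, del, List.getD_eq_getElem?_getD, List.getElem?_eraseIdx]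
    by_cases h : i < k
    · simp [h]
    · simp [h]

theorem exists_eraseIdx_of_sublist {y x : List Bool} (h : List.Sublist y x) :
    y.length + 1 = x.length → ∃ k < x.length, y = x.eraseIdx k := by
  induction h with
  | slnil => simp
  | @cons l₁ l₂ a h ih =>
    intro hl
    refine ⟨0, by simp, ?_⟩
    simpa using h.eq_of_length (by simpa using hl)
  | @cons_cons l₁ l₂ a h ih =>
    intro hl
    obtain ⟨k, hk, rfl⟩ := ih (by simpa using hl)
    exact ⟨k + 1, by simpa using hk, by simp⟩

theorem eq_of_hamming_eq_zero {u v : List Bool} (hl : v.length = u.length)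
    (h : hamming u v = 0) : u = v := by
  induction u generalizing v with
  | nil => exact (List.length_eq_zero_iff.1 hl).symm
  | cons a u ih =>
    cases v with
    | nil => simp at hl
    | cons b v =>
      simp only [hamming, List.zip_cons_cons, List.countP_cons] at h ih
      have := ih (v := v) (by simpa using hl) (by omega)
      cases a <;> cases b <;> simp_all

theorem exists_of_hamming_le_one {u v : List Bool} (hl : v.length = u.length)
    (h : hamming u v ≤ 1) : ∃ e, ∀ i, i ≠ e → u.getD i false = v.getD i false := by
  induction u generalizing v with
  | nil => exact ⟨0, fun i _ => by simp_all⟩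
  | cons a u ih =>
    cases v with
    | nil => simp at hl
    | cons b v =>
      have hc : hamming (a :: u) (b :: v) = hamming u v + if a != b then 1 else 0 := by
        simp [hamming, List.countP_cons]
      by_cases hab : a = b
      · obtain ⟨e, he⟩ := ih (v := v) (by simpa using hl) (by omega)
        refine ⟨e + 1, fun i hi => ?_⟩
        rcases i with _ | i
        · simp [hab]
        · simpa using he i (by omega)
      · have h0 : hamming u v = 0 := by
          rw [hc] at h; simp [hab] at h; exact h
        have := eq_of_hamming_eq_zero (by simpa using hl) h0
        subst this
        refine ⟨0, fun i hi => ?_⟩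
        rcases i with _ | i
        · simp at hi
        · simp

theorem exists_of_mem_ball {x z : List Bool} (h : z ∈ ball x) :
    z.length + 1 = x.length ∧ ∃ d, 1 ≤ d ∧ d ≤ x.length ∧
      ∃ e, ∀ i, i ≠ e → seq z i = del (seq x) d i := by
  obtain ⟨w, ⟨hw, hs⟩, hz, hh⟩ := h
  obtain ⟨k, hk, rfl⟩ := exists_eraseIdx_of_sublist hs hw
  obtain ⟨e, he⟩ := exists_of_hamming_le_one hz hh
  refine ⟨by omega, k + 1, by omega, by omega, e + 1, fun i hi => ?_⟩
  rw [← seq_eraseIdx]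
  rcases i with _ | i
  · simp [seq]
  · rw [seq_succ, seq_succ, he i (by omega)]

theorem length_diffSeq (x : List Bool) : (diffSeq x).length = x.length + 1 := by
  simp [diffSeq]

theorem seq_diffSeq (x : List Bool) (i : ℕ) : seq (diffSeq x) (i + 1) = chg (seq x) i := by
  rw [seq_succ]
  by_cases hi : i < x.length + 1
  · have h1 : (diffSeq x).getD i false =
        Bool.xor ((x ++ [false]).getD i false) ((false :: x).getD i false) := by
      rw [List.getD_eq_getElem _ _ (by rw [length_diffSeq]; exact hi),
        List.getD_eq_getElem _ _ (by simpa using hi), List.getD_eq_getElem _ _ (by simpa using hi)]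
      simp [diffSeq]
    have h2 : (x ++ [false]).getD i false = x.getD i false := by
      simp only [List.getD_eq_getElem?_getD, List.getElem?_append]
      split
      · rfl
      · rename_i h
        have : i = x.length := by omega
        subst this; simp
    rw [h1, h2]
    unfold chg
    rw [seq_succ]
    unfold seq
    cases x.getD i false <;> cases (false :: x).getD i false <;> simp
  · rw [List.getD_eq_default _ _ (by rw [length_diffSeq]; omega)]
    have hw := isWord_seq x
    simp [chg, hw.supp i (by omega), hw.supp (i + 1) (by omega)]

theorem sum_Ico_one_succ {M : Type*} [AddCommMonoid M] (f : ℕ → M) (n : ℕ) :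
    ∑ i ∈ Finset.Ico 1 (n + 1), f i = ∑ i ∈ Finset.range n, f (i + 1) := by
  rw [Finset.sum_Ico_eq_sum_range]
  simp [add_comm]

theorem wt_eq_sum (x : List Bool) : (wt x : ℤ) = ∑ i ∈ Finset.range x.length, seq x (i + 1) := by
  induction x with
  | nil => simp [wt]
  | cons a x ih =>
    have : ∀ i, seq (a :: x) (i + 1 + 1) = seq x (i + 1) := fun i => by
      rw [seq_succ, seq_succ]; simp
    rw [List.length_cons, Finset.sum_range_succ', Finset.sum_congr rfl fun i _ => this i, ← ih,
      seq_succ]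
    cases a <;> simp [wt]

/-- Interchanging the two sums turns the syndrome into a moment of the suffix sums, the quantities
that a deletion changes only slightly. -/
theorem VT_succ_eq (k : ℕ) (x : List Bool) :
    (VT (k + 1) x : ℤ) =
      ∑ j ∈ Finset.Ico 1 (x.length + 1), (j : ℤ) ^ k * suf (x.length + 1) (seq x) j := by
  unfold VT suf
  push_cast
  simp only [seq_succ_toNat, Finset.mul_sum]
  rw [← sum_Ico_one_succ (fun i => ∑ j ∈ Finset.Icc 1 i, (j : ℤ) ^ k * seq x i)]
  apply Finset.sum_comm'
  intro i j
  simp only [Finset.mem_Ico, Finset.mem_Icc]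
  omega

theorem sum_suf_eq (N : ℕ) (a : ℕ → ℤ) : ∑ j ∈ Finset.Ico 1 N, suf N a j = mom N a := by
  unfold suf mom
  rw [Finset.sum_comm' (t' := Finset.range N) (s' := fun i => Finset.Ico 1 (i + 1))]
  · refine Finset.sum_congr rfl fun i _ => by simp
  · intro i j
    simp only [Finset.mem_Ico, Finset.mem_range]
    omega

theorem VT_zero_eq (x : List Bool) : (VT 0 x : ℤ) = suf (x.length + 1) (seq x) 0 := by
  unfold VT suf
  rw [wt_eq_sum, ← Finset.range_eq_Ico, Finset.sum_range_succ', (isWord_seq x).zero, add_zero]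

theorem VT_one_eq (x : List Bool) : (VT 1 x : ℤ) = mom (x.length + 1) (seq x) := by
  rw [VT_succ_eq, ← sum_suf_eq]; simp

theorem VT_zero_diffSeq (x : List Bool) :
    (VT 0 (diffSeq x) : ℤ) = suf (x.length + 1) (chg (seq x)) 0 := by
  unfold VT suf
  rw [wt_eq_sum, ← Finset.range_eq_Ico, length_diffSeq]
  exact Finset.sum_congr rfl fun i _ => seq_diffSeq x i

theorem suf_seq_diffSeq (x : List Bool) (j : ℕ) :
    suf (x.length + 1 + 1) (seq (diffSeq x)) (j + 1) = suf (x.length + 1) (chg (seq x)) j := by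
  unfold suf
  rw [← Finset.sum_Ico_add' (fun i => seq (diffSeq x) i) j (x.length + 1) 1]
  exact Finset.sum_congr rfl fun i _ => seq_diffSeq x i

theorem VT_one_diffSeq (x : List Bool) :
    (VT 1 (diffSeq x) : ℤ) = ∑ j ∈ Finset.range (x.length + 1),
      suf (x.length + 1) (chg (seq x)) j := by
  rw [VT_succ_eq, length_diffSeq, sum_Ico_one_succ]
  refine Finset.sum_congr rfl fun i _ => by rw [suf_seq_diffSeq]; simp

theorem wt_drop_take (x : List Bool) (a m : ℕ) (h : a + m ≤ x.length) :
    (wt ((x.drop a).take m) : ℤ) = ∑ i ∈ Finset.Ico (a + 1) (a + m + 1), seq x i := by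
  rw [wt_eq_sum, Finset.sum_Ico_eq_sum_range]
  have : ((x.drop a).take m).length = m := by simp; omega
  rw [this, show a + m + 1 - (a + 1) = m by omega]
  refine Finset.sum_congr rfl fun i hi => ?_
  have hi := Finset.mem_range.1 hi
  rw [show a + 1 + i = a + i + 1 by ring, seq_succ, seq_succ]
  simp [List.getD_eq_getElem?_getD, hi]

/-! ### The effect of a deletion on suffix sums and first moments -/

section Suffix

variable {N d : ℕ} {A : ℕ → ℤ}

theorem suf_self (N : ℕ) (a : ℕ → ℤ) : suf N a N = 0 := by simp [suf]

theorem suf_step {N j : ℕ} (h : j < N) (a : ℕ → ℤ) : suf N a j = a j + suf N a (j + 1) :=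
  Finset.sum_eq_sum_Ico_succ_bot h a

theorem suf_sub_suf (N : ℕ) (a b : ℕ → ℤ) (j : ℕ) :
    suf N a j - suf N b j = suf N (fun i => a i - b i) j := by
  simp [suf]

theorem suf_del (hd : d < N) (hN : A N = 0) {j : ℕ} (hj : j ≤ N) :
    suf N A j = suf N (del A d) j + if j ≤ d then A d else del A d (j - 1) := by
  induction hj using Nat.decreasingInduction with
  | self => rw [suf_self, suf_self, if_neg (by omega), del, if_neg (by omega),
      Nat.sub_add_cancel (by omega), hN, add_zero]
  | of_succ j hj ih =>
    rw [suf_step hj, suf_step hj (del A d), ih]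
    rcases lt_trichotomy j d with h | h | h
    · rw [if_pos (by omega), if_pos (by omega)]
      simp only [del, if_pos h]; ring
    · subst h
      simp only [le_refl, if_true, if_neg (Nat.not_succ_le_self j), Nat.add_sub_cancel]
      ring
    · rw [if_neg (by omega), if_neg (by omega), Nat.add_sub_cancel]
      have : del A d (j - 1) = A j := by
        rw [del, if_neg (by omega), Nat.sub_add_cancel (by omega)]
      rw [this]; ring

/-- The number of changes that a deletion removes. -/
def chgLoss (A : ℕ → ℤ) (d : ℕ) : ℤ := chg A (d - 1) + chg A d - chg (del A d) (d - 1)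

/-- A deletion merges the changes on either side of `d` into one. A suffix starting before `d` sees
this merger, and a later one only loses its first change. -/
theorem suf_chg_del (hd1 : 1 ≤ d) (hd : d < N) (hN : A N = 0) (hN1 : A (N + 1) = 0) {j : ℕ}
    (hj : j ≤ N) :
    suf N (chg A) j = suf N (chg (del A d)) j +
      if j < d then chgLoss A d else if j = d then chg A d else chg (del A d) (j - 1) := by
  induction hj using Nat.decreasingInduction with
  | self =>
    rw [suf_self, suf_self, if_neg (by omega), if_neg (by omega), chg, del, del,
      if_neg (by omega), if_neg (by omega), Nat.sub_add_cancel (by omega), hN, hN1]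
    simp
  | of_succ j hj ih =>
    rw [suf_step hj, suf_step hj (chg (del A d)), ih]
    rcases lt_trichotomy j d with h | h | h
    · rcases Nat.lt_or_ge (j + 1) d with h' | h'
      · rw [if_pos (by omega), if_pos (by omega)]
        have : chg (del A d) j = chg A j := by simp only [chg, del, if_pos h, if_pos h']
        rw [this]; ring
      · have h2 : j + 1 = d := by omega
        rw [if_neg (by omega), if_pos h2, if_pos h, chgLoss, ← h2, Nat.add_sub_cancel]
        ring
    · subst h
      rw [if_neg (by omega), if_neg (by omega), if_neg (by omega), if_pos rfl, Nat.add_sub_cancel]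
      ring
    · rw [if_neg (by omega), if_neg (by omega), if_neg (by omega), if_neg (by omega),
        Nat.add_sub_cancel]
      have : chg (del A d) (j - 1) = chg A j := by
        simp only [chg, del, if_neg (show ¬ j - 1 < d by omega), if_neg (show ¬ j < d by omega),
          Nat.sub_add_cancel (show 1 ≤ j by omega)]
      rw [this]; ring

theorem sum_Ico_ite_eq (a : ℕ → ℤ) (c : ℤ) {N d : ℕ} (hd : d < N) :
    ∑ j ∈ Finset.Ico 1 N, (if j ≤ d then c else a (j - 1)) =
      d * c + ∑ i ∈ Finset.Ico d (N - 1), a i := by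
  induction N, hd using Nat.le_induction with
  | base =>
    rw [Nat.succ_sub_one, Finset.Ico_self, Finset.sum_empty, add_zero,
      Finset.sum_congr rfl (g := fun _ => c) fun j hj => if_pos (by
        have := Finset.mem_Ico.1 hj; omega)]
    simp
  | succ N hN ih =>
    rw [Finset.sum_Ico_succ_top (by omega), ih, if_neg (by omega)]
    obtain ⟨M, rfl⟩ : ∃ M, N = M + 1 := ⟨N - 1, by omega⟩
    simp only [Nat.add_sub_cancel]
    rw [Finset.sum_Ico_succ_top (by omega)]; ring

theorem suf_eq_of_zero (a : ℕ → ℤ) {N j : ℕ} (hj : j < N) (h : a (N - 1) = 0) :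
    suf N a j = ∑ i ∈ Finset.Ico j (N - 1), a i := by
  obtain ⟨M, rfl⟩ : ∃ M, N = M + 1 := ⟨N - 1, by omega⟩
  rw [Nat.add_sub_cancel] at *
  rw [suf, Finset.sum_Ico_succ_top (by omega), h, add_zero]

theorem mom_del (hd : d < N) (hN : A N = 0) :
    mom N A = mom N (del A d) + d * A d + suf N (del A d) d := by
  rw [← sum_suf_eq, ← sum_suf_eq, Finset.sum_congr rfl fun j hj =>
    suf_del hd hN (Finset.mem_Ico.1 hj).2.le, Finset.sum_add_distrib, sum_Ico_ite_eq _ _ hd,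
    suf_eq_of_zero _ hd]
  · ring
  · rw [del, if_neg (by omega), Nat.sub_add_cancel (by omega), hN]

theorem mom_chg_del (hd1 : 1 ≤ d) (hd : d < N) (hN : A N = 0) (hN1 : A (N + 1) = 0) :
    mom N (chg A) = mom N (chg (del A d)) + (d - 1) * chgLoss A d + chg A d +
      suf N (chg (del A d)) d := by
  have h : ∑ j ∈ Finset.Ico 1 N,
      (if j < d then chgLoss A d else if j = d then chg A d else chg (del A d) (j - 1)) =
      ∑ j ∈ Finset.Ico 1 N, ((if j ≤ d then chgLoss A d else chg (del A d) (j - 1)) +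
        if j = d then chg A d - chgLoss A d else 0) := by
    refine Finset.sum_congr rfl fun j _ => ?_
    rcases lt_trichotomy j d with h | h | h
    · rw [if_pos h, if_pos h.le, if_neg h.ne, add_zero]
    · subst h; simp
    · rw [if_neg (by omega), if_neg (by omega), if_neg (by omega), if_neg (by omega), add_zero]
  rw [← sum_suf_eq, ← sum_suf_eq, Finset.sum_congr rfl fun j hj =>
    suf_chg_del hd1 hd hN hN1 (Finset.mem_Ico.1 hj).2.le, Finset.sum_add_distrib, h,
    Finset.sum_add_distrib, sum_Ico_ite_eq _ _ hd, Finset.sum_ite_eq', if_pos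
      (Finset.mem_Ico.2 ⟨hd1, hd⟩), suf_eq_of_zero _ hd]
  · ring
  · rw [chg, del, del, if_neg (by omega), if_neg (by omega), Nat.sub_add_cancel (by omega), hN, hN1]
    simp

end Suffix

/-! ### Substitutions, and pairs of words with a common neighbour -/

theorem IsWord.chg_bit {n : ℕ} {A : ℕ → ℤ} (hA : IsWord n A) (i : ℕ) :
    chg A i = 0 ∨ chg A i = 1 := by
  unfold chg
  rcases hA.bit i with h | h <;> rcases hA.bit (i + 1) with h' | h' <;> rw [h, h'] <;> simp

theorem IsWord.del {n d : ℕ} {A : ℕ → ℤ} (hA : IsWord (n + 1) A) (hd : 1 ≤ d) (hd' : d ≤ n + 1) :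
    IsWord n (del A d) := by
  refine ⟨fun i => ?_, ?_, fun i hi => ?_⟩
  · unfold DelSub.del; split
    exacts [hA.bit _, hA.bit _]
  · rw [DelSub.del, if_pos (by omega), hA.zero]
  · rw [DelSub.del, if_neg (by omega), hA.supp _ (by omega)]

theorem chgLoss_eq {n : ℕ} {A : ℕ → ℤ} (hA : IsWord n A) {d : ℕ} (hd : 1 ≤ d) :
    chgLoss A d = 0 ∨ chgLoss A d = 2 := by
  obtain ⟨d, rfl⟩ : ∃ k, d = k + 1 := ⟨d - 1, by omega⟩
  unfold chgLoss chg DelSub.del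
  simp only [Nat.add_sub_cancel, Nat.lt_succ_self, if_true, lt_self_iff_false, if_false]
  rcases hA.bit d with h | h <;> rcases hA.bit (d + 1) with h' | h' <;>
    rcases hA.bit (d + 1 + 1) with h'' | h'' <;> rw [h, h', h''] <;> simp

/-- The effect on the changes of altering a single entry. -/
theorem exists_chg_flip {n m N e : ℕ} {G H : ℕ → ℤ} (hG : IsWord n G) (hH : IsWord m H)
    (he1 : 1 ≤ e) (heN : e < N) (h : ∀ i, i ≠ e → G i = H i) :
    ∃ s : ℤ, (s = 0 ∨ s = 2 ∨ s = -2) ∧ (G e = H e → s = 0) ∧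
      |mom N (chg G) - mom N (chg H) - e * s| ≤ 1 ∧
      (∀ j, |suf N (chg G) j - suf N (chg H) j| ≤ 2) ∧
      suf N (chg G) 0 - suf N (chg H) 0 = s := by
  obtain ⟨k, rfl⟩ : ∃ k, e = k + 1 := ⟨e - 1, by omega⟩
  set u := chg G k - chg H k with hu
  set v := chg G (k + 1) - chg H (k + 1) with hv
  have hgen : ∀ i, chg G i - chg H i = (if i = k then u else 0) + if i = k + 1 then v else 0 := by
    intro i
    by_cases h1 : i = k
    · subst h1; simp [hu]
    · by_cases h2 : i = k + 1
      · subst h2; simp [hv]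
      · rw [if_neg h1, if_neg h2, chg, chg, h i h2, h (i + 1) (by omega)]; simp
  have hsuf : ∀ j, suf N (chg G) j - suf N (chg H) j =
      (if j ≤ k then u else 0) + if j ≤ k + 1 then v else 0 := by
    intro j
    rw [suf_sub_suf, suf, Finset.sum_congr rfl fun i _ => hgen i, Finset.sum_add_distrib,
      Finset.sum_ite_eq', Finset.sum_ite_eq']
    simp [show k < N by omega, heN]
  have hmom : mom N (chg G) - mom N (chg H) = k * u + (k + 1) * v := by
    rw [mom, mom, ← Finset.sum_sub_distrib, Finset.sum_congr rfl
      (g := fun i : ℕ => (if i = k then (i : ℤ) * u else 0) + if i = k + 1 then (i : ℤ) * v else 0)]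
    · rw [Finset.sum_add_distrib, Finset.sum_ite_eq', Finset.sum_ite_eq']
      simp [show k < N by omega, heN]
    · intro i _
      rw [← mul_sub, hgen]
      split_ifs <;> ring
  have hk := h k (by omega)
  have hk2 := h (k + 1 + 1) (by omega)
  have huv : (u = 0 ∨ u = 1 ∨ u = -1) ∧ (v = 0 ∨ v = 1 ∨ v = -1) ∧
      (u + v = 0 ∨ u + v = 2 ∨ u + v = -2) ∧ (G (k + 1) = H (k + 1) → u + v = 0) := by
    rw [hu, hv, chg, chg, chg, chg, hk, hk2]
    rcases hH.bit k with h1 | h1 <;> rcases hH.bit (k + 1) with h2 | h2 <;>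
      rcases hG.bit (k + 1) with h3 | h3 <;> rcases hH.bit (k + 1 + 1) with h4 | h4 <;>
      rw [h1, h2, h3, h4] <;> simp
  obtain ⟨hu', hv', hs, hs0⟩ := huv
  refine ⟨u + v, hs, hs0, ?_, ?_, ?_⟩
  -- The two altered changes sit at `e - 1` and `e`; placing both at `e` costs only `u`.
  · rw [hmom, show (k * u + (k + 1) * v - ((k + 1 : ℕ) : ℤ) * (u + v)) = -u by push_cast; ring]
    rcases hu' with h | h | h <;> rw [h] <;> simp
  · intro j
    rw [hsuf]
    rcases hu' with h | h | h <;> rcases hv' with h' | h' | h' <;> rw [h, h'] <;> split_ifs <;> simp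
  · rw [hsuf]; simp

/-- `A` without the entry `d` and `B` without the entry `d'` differ at most in the entries `e < f`,
by `σ` and `τ`. -/
structure Sol (n : ℕ) (A B : ℕ → ℤ) (d d' e f : ℕ) (σ τ : ℤ) : Prop where
  d1 : 1 ≤ d
  dn : d ≤ n
  d1' : 1 ≤ d'
  dn' : d' ≤ n
  e1 : 1 ≤ e
  ef : e < f
  fn : f ≤ n
  sig : σ = 0 ∨ σ = 1 ∨ σ = -1
  tau : τ = 0 ∨ τ = 1 ∨ τ = -1
  eq : ∀ i, del A d i - del B d' i = (if i = e then σ else 0) + if i = f then τ else 0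

theorem Sol.symm {n : ℕ} {A B : ℕ → ℤ} {d d' e f : ℕ} {σ τ : ℤ} (h : Sol n A B d d' e f σ τ) :
    Sol n B A d' d e f (-σ) (-τ) := by
  refine ⟨h.d1', h.dn', h.d1, h.dn, h.e1, h.ef, h.fn, ?_, ?_, fun i => ?_⟩
  · rcases h.sig with h | h | h <;> rw [h] <;> simp
  · rcases h.tau with h | h | h <;> rw [h] <;> simp
  · have := h.eq i
    split_ifs at * <;> linarith

/-- A missing position is padded by a neighbour, or by the pair `1, 2`, with coefficient 0. Later
case distinctions can then always assume two ordered positions in `[1, n]`. -/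
theorem exists_pair_support_of_single {n e : ℕ} (hn : 2 ≤ n) {g : ℕ → ℤ}
    (hg : ∀ i, g i = 0 ∨ g i = 1 ∨ g i = -1)
    (h0 : g 0 = 0) (hs : ∀ i, n ≤ i → g i = 0) (h : ∀ i, i ≠ e → g i = 0) :
    ∃ e f : ℕ, ∃ σ τ : ℤ, 1 ≤ e ∧ e < f ∧ f ≤ n ∧ (σ = 0 ∨ σ = 1 ∨ σ = -1) ∧
      (τ = 0 ∨ τ = 1 ∨ τ = -1) ∧
      ∀ i, g i = (if i = e then σ else 0) + if i = f then τ else 0 := by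
  by_cases he : 1 ≤ e ∧ e < n
  · refine ⟨e, e + 1, g e, 0, he.1, by omega, by omega, hg e, by simp, fun i => ?_⟩
    by_cases hi : i = e
    · subst hi; simp
    · rw [h i hi]; simp [hi]
  · refine ⟨1, 2, 0, 0, le_rfl, by omega, hn, by simp, by simp, fun i => ?_⟩
    by_cases hi : i = e
    · subst hi
      rcases Nat.eq_zero_or_pos i with h' | h'
      · subst h'; simpa using h0
      · simpa using hs i (by omega)
    · simpa using h i hi

theorem exists_pair_support {n e f : ℕ} (hn : 2 ≤ n) {g : ℕ → ℤ}
    (hg : ∀ i, g i = 0 ∨ g i = 1 ∨ g i = -1)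
    (h0 : g 0 = 0) (hs : ∀ i, n ≤ i → g i = 0) (h : ∀ i, i ≠ e → i ≠ f → g i = 0) :
    ∃ e f : ℕ, ∃ σ τ : ℤ, 1 ≤ e ∧ e < f ∧ f ≤ n ∧ (σ = 0 ∨ σ = 1 ∨ σ = -1) ∧
      (τ = 0 ∨ τ = 1 ∨ τ = -1) ∧
      ∀ i, g i = (if i = e then σ else 0) + if i = f then τ else 0 := by
  wlog hef : e ≤ f generalizing e f
  · exact this (fun i h1 h2 => h i h2 h1) (by omega)
  rcases hef.eq_or_lt with hef | hef
  · subst hef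
    exact exists_pair_support_of_single hn hg h0 hs fun i hi => h i hi hi
  rcases Nat.eq_zero_or_pos e with he | he
  · subst he
    exact exists_pair_support_of_single (e := f) hn hg h0 hs fun i hi => by
      by_cases h' : i = 0
      · rw [h', h0]
      · exact h i h' hi
  by_cases hf : n ≤ f
  · exact exists_pair_support_of_single (e := e) hn hg h0 hs fun i hi => by
      by_cases h' : i = f
      · rw [h']; exact hs f hf
      · exact h i hi h'
  · refine ⟨e, f, g e, g f, he, hef, by omega, hg e, hg f, fun i => ?_⟩
    by_cases hi : i = e
    · subst hi; simp [hef.ne]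
    · by_cases hi' : i = f
      · subst hi'; simp [hi]
      · simp [hi, hi', h i hi hi']

theorem exists_sol {n : ℕ} (hn : 2 ≤ n) {A B Z : ℕ → ℤ} (hA : IsWord n A) (hB : IsWord n B)
    {d d' e f : ℕ} (hd : 1 ≤ d) (hdn : d ≤ n) (hd' : 1 ≤ d') (hdn' : d' ≤ n)
    (he : ∀ i, i ≠ e → Z i = del A d i) (hf : ∀ i, i ≠ f → Z i = del B d' i) :
    ∃ e f σ τ, Sol n A B d d' e f σ τ := by
  obtain ⟨m, rfl⟩ : ∃ m, n = m + 1 := ⟨n - 1, by omega⟩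
  have hA' := hA.del hd hdn
  have hB' := hB.del hd' hdn'
  obtain ⟨e, f, σ, τ, h1, h2, h3, h4, h5, h6⟩ := exists_pair_support hn
    (g := fun i => del A d i - del B d' i) (e := e) (f := f)
    (fun i => by
      rcases hA'.bit i with h | h <;> rcases hB'.bit i with h' | h' <;> rw [h, h'] <;> simp)
    (by simp [hA'.zero, hB'.zero])
    (fun i hi => by simp [hA'.supp i (by omega), hB'.supp i (by omega)])
    (fun i h h' => by rw [← he i h, ← hf i h']; simp)
  exact ⟨e, f, σ, τ, hd, hdn, hd', hdn', h1, h2, h3, h4, h5, h6⟩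

section

variable {n : ℕ} {A B : ℕ → ℤ} {d d' e f : ℕ} {σ τ : ℤ}

theorem Sol.suf_sub (h : Sol n A B d d' e f σ τ) (j : ℕ) :
    suf (n + 1) (del A d) j - suf (n + 1) (del B d') j =
      (if j ≤ e then σ else 0) + if j ≤ f then τ else 0 := by
  have := h.ef
  have := h.fn
  rw [suf_sub_suf, suf, Finset.sum_congr rfl fun i _ => h.eq i, Finset.sum_add_distrib,
    Finset.sum_ite_eq', Finset.sum_ite_eq']
  simp [show e < n + 1 by omega, show f < n + 1 by omega]

theorem Sol.mom_sub (h : Sol n A B d d' e f σ τ) :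
    mom (n + 1) (del A d) - mom (n + 1) (del B d') = e * σ + f * τ := by
  have := h.ef
  have := h.fn
  rw [mom, mom, ← Finset.sum_sub_distrib, Finset.sum_congr rfl
    (g := fun i : ℕ => (if i = e then (i : ℤ) * σ else 0) + if i = f then (i : ℤ) * τ else 0)]
  · rw [Finset.sum_add_distrib, Finset.sum_ite_eq', Finset.sum_ite_eq']
    simp [show e < n + 1 by omega, show f < n + 1 by omega]
  · intro i _
    rw [← mul_sub, h.eq]
    split_ifs <;> ring

/-- The effect on the changes of altering the entries `e` and `f`. -/
theorem Sol.exists_chg (hA : IsWord n A) (hB : IsWord n B) (h : Sol n A B d d' e f σ τ) :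
    ∃ s s' : ℤ, (s = 0 ∨ s = 2 ∨ s = -2) ∧ (s' = 0 ∨ s' = 2 ∨ s' = -2) ∧ (σ = 0 → s = 0) ∧
      (τ = 0 → s' = 0) ∧
      |mom (n + 1) (chg (del A d)) - mom (n + 1) (chg (del B d')) - (e * s + f * s')| ≤ 2 ∧
      (∀ j, |suf (n + 1) (chg (del A d)) j - suf (n + 1) (chg (del B d')) j| ≤ 4) ∧
      suf (n + 1) (chg (del A d)) 0 - suf (n + 1) (chg (del B d')) 0 = s + s' := by
  obtain ⟨m, rfl⟩ : ∃ m, n = m + 1 := ⟨n - 1, by have := h.dn; have := h.d1; omega⟩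
  have hA' := hA.del h.d1 h.dn
  have hB' := hB.del h.d1' h.dn'
  have h1 := h.e1
  have h2 := h.ef
  have h3 := h.fn
  -- An intermediate word: `G` differs from `del B d'` only at `e` and from `del A d` only at `f`,
  -- so the single-entry estimate applies twice.
  set G : ℕ → ℤ := fun i => if i = e then del A d i else del B d' i with hG
  have hGw : IsWord m G := by
    refine ⟨fun i => ?_, ?_, fun i hi => ?_⟩
    · rw [hG]; dsimp only; split_ifs
      exacts [hA'.bit i, hB'.bit i]
    · rw [hG]; dsimp only; split_ifs
      exacts [hA'.zero, hB'.zero]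
    · rw [hG]; dsimp only; split_ifs
      exacts [hA'.supp i hi, hB'.supp i hi]
  have eqe := h.eq e
  have eqf := h.eq f
  rw [if_pos rfl, if_neg (by omega), add_zero] at eqe
  rw [if_neg (by omega), if_pos rfl, zero_add] at eqf
  have hGe : G e = del A d e := if_pos rfl
  have hGf : G f = del B d' f := if_neg (by omega)
  obtain ⟨s, hs, hs0, hs1, hs2, hs3⟩ := exists_chg_flip (N := m + 1 + 1) hGw hB' h1 (by omega)
    (fun i hi => if_neg hi)
  obtain ⟨s', hs', hs0', hs1', hs2', hs3'⟩ := exists_chg_flip (N := m + 1 + 1) hA' hGw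
    (e := f) (by omega) (by omega) (fun i hi => by
      rw [hG]; dsimp only
      split_ifs with h'
      · rfl
      · have := h.eq i
        rw [if_neg h', if_neg hi] at this
        linarith)
  refine ⟨s, s', hs, hs', fun h0 => hs0 (by rw [hGe]; linarith),
    fun h0 => hs0' (by rw [hGf]; linarith), ?_, fun j => ?_, by linarith⟩
  · rw [abs_le] at *
    constructor <;> linarith
  · have a1 := abs_le.1 (hs2 j)
    have a2 := abs_le.1 (hs2' j)
    rw [abs_le]
    constructor <;> linarith

/-- The substitutions contribute at most 1 each, and the two deletions together the difference of
two bits. This is the source of the moduli `4`, `3 * n + 1` and `3 * (2 * P) ^ k`. -/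
theorem Sol.abs_suf_le (hA : IsWord n A) (hB : IsWord n B) (h : Sol n A B d d' e f σ τ) {j : ℕ}
    (hj : j ≤ n + 1) : |suf (n + 1) A j - suf (n + 1) B j| ≤ 3 := by
  obtain ⟨m, rfl⟩ : ∃ m, n = m + 1 := ⟨n - 1, by have := h.dn; have := h.d1; omega⟩
  have hA' := hA.del h.d1 h.dn
  have hB' := hB.del h.d1' h.dn'
  have h1 := h.suf_sub j
  have h2 := suf_del (N := m + 1 + 1) (d := d) (A := A) (by have := h.dn; omega)
    (hA.supp _ (by omega)) hj
  have h3 := suf_del (N := m + 1 + 1) (d := d') (A := B) (by have := h.dn'; omega)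
    (hB.supp _ (by omega)) hj
  have b1 : ∀ {c : ℤ}, c = 0 ∨ c = 1 ∨ c = -1 → -1 ≤ c ∧ c ≤ 1 := by rintro c (h | h | h) <;> omega
  have b2 : ∀ {c : ℤ}, c = 0 ∨ c = 1 → 0 ≤ c ∧ c ≤ 1 := by rintro c (h | h) <;> omega
  have := b1 h.sig
  have := b1 h.tau
  have := b2 (hA.bit d)
  have := b2 (hB.bit d')
  have := b2 (hA'.bit (j - 1))
  have := b2 (hB'.bit (j - 1))
  rw [abs_le]
  split_ifs at h1 h2 h3 <;> omega

/-- At most 4 comes from the substitutions and 2 from the deletions, which explains the moduli `7`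
and `6 * (n + 1) + 1`. -/
theorem Sol.abs_suf_chg_le (hA : IsWord n A) (hB : IsWord n B) (h : Sol n A B d d' e f σ τ)
    {j : ℕ} (hj : j ≤ n + 1) : |suf (n + 1) (chg A) j - suf (n + 1) (chg B) j| ≤ 6 := by
  obtain ⟨s, s', _, _, _, _, _, h1, _⟩ := h.exists_chg hA hB
  obtain ⟨m, rfl⟩ : ∃ m, n = m + 1 := ⟨n - 1, by have := h.dn; have := h.d1; omega⟩
  have hA' := hA.del h.d1 h.dn
  have hB' := hB.del h.d1' h.dn'
  have h1 := abs_le.1 (h1 j)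
  have h2 := suf_chg_del (N := m + 1 + 1) (d := d) (A := A) h.d1 (by have := h.dn; omega)
    (hA.supp _ (by omega)) (hA.supp _ (by omega)) hj
  have h3 := suf_chg_del (N := m + 1 + 1) (d := d') (A := B) h.d1' (by have := h.dn'; omega)
    (hB.supp _ (by omega)) (hB.supp _ (by omega)) hj
  have b2 : ∀ {c : ℤ}, c = 0 ∨ c = 1 → 0 ≤ c ∧ c ≤ 1 := by rintro c (h | h) <;> omega
  have b3 : ∀ {c : ℤ}, c = 0 ∨ c = 2 → 0 ≤ c ∧ c ≤ 2 := by rintro c (h | h) <;> omega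
  have := b3 (chgLoss_eq hA h.d1)
  have := b3 (chgLoss_eq hB h.d1')
  have := b2 (hA.chg_bit d)
  have := b2 (hB.chg_bit d')
  have := b2 (hA'.chg_bit (j - 1))
  have := b2 (hB'.chg_bit (j - 1))
  rw [abs_le]
  split_ifs at h2 h3 <;> omega

/-- The consequence of equal weights and first moments. -/
theorem Sol.moment_eq (hA : IsWord n A) (hB : IsWord n B) (h : Sol n A B d d' e f σ τ)
    (hdd : d ≤ d') (h0 : suf (n + 1) A 0 = suf (n + 1) B 0) (h1 : mom (n + 1) A = mom (n + 1) B) :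
    σ + τ + A d - B d' = 0 ∧
      |e * σ + f * τ + d * A d - d' * B d' + ∑ i ∈ Finset.Ico d d', B i| ≤ 2 := by
  have hdn := h.dn
  have hdn' := h.dn'
  have a1 := suf_del (N := n + 1) (d := d) (A := A) (by omega) (hA.supp _ (by omega))
    (Nat.zero_le _)
  have a2 := suf_del (N := n + 1) (d := d') (A := B) (by omega) (hB.supp _ (by omega))
    (Nat.zero_le _)
  have a3 := h.suf_sub 0
  simp only [Nat.zero_le, if_true] at a1 a2 a3
  refine ⟨by linarith, ?_⟩
  have m1 := mom_del (N := n + 1) (d := d) (A := A) (by omega) (hA.supp _ (by omega))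
  have m2 := mom_del (N := n + 1) (d := d') (A := B) (by omega) (hB.supp _ (by omega))
  have m3 := h.mom_sub
  have s1 := h.suf_sub d
  -- The entries of `B` before `d'` survive the deletion, so the shift contributes the weight of `B`
  -- between the deletions.
  have s2 : suf (n + 1) (del B d') d = ∑ i ∈ Finset.Ico d d', B i + suf (n + 1) (del B d') d' := by
    rw [suf, suf, ← Finset.sum_Ico_consecutive _ hdd (show d' ≤ n + 1 by omega)]
    congr 1
    refine Finset.sum_congr rfl fun i hi => ?_
    rw [del, if_pos (Finset.mem_Ico.1 hi).2]
  have b1 : ∀ {c : ℤ}, c = 0 ∨ c = 1 ∨ c = -1 → -1 ≤ c ∧ c ≤ 1 := by rintro c (h | h | h) <;> omega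
  have := b1 h.sig
  have := b1 h.tau
  rw [abs_le]
  split_ifs at s1 <;> constructor <;> linarith

/-- The consequence of equal weights and first moments of the differential sequences. -/
theorem Sol.moment_chg_eq (hA : IsWord n A) (hB : IsWord n B) (h : Sol n A B d d' e f σ τ)
    (hdd : d ≤ d') (h0 : suf (n + 1) (chg A) 0 = suf (n + 1) (chg B) 0)
    (h1 : mom (n + 1) (chg A) = mom (n + 1) (chg B)) :
    ∃ s s' α β : ℤ, (s = 0 ∨ s = 2 ∨ s = -2) ∧ (s' = 0 ∨ s' = 2 ∨ s' = -2) ∧ (σ = 0 → s = 0) ∧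
      (τ = 0 → s' = 0) ∧ (α = 0 ∨ α = 2) ∧ (β = 0 ∨ β = 2) ∧ s + s' + α - β = 0 ∧
      |e * s + f * s' + d * α - d' * β + ∑ i ∈ Finset.Ico d d', chg B i| ≤ 12 := by
  obtain ⟨s, s', hs, hs', hs0, hs0', hm, hsuf, hsum⟩ := h.exists_chg hA hB
  have hd1 := h.d1
  have hd1' := h.d1'
  have hdn := h.dn
  have hdn' := h.dn'
  have hα := chgLoss_eq hA hd1
  have hβ := chgLoss_eq hB hd1'
  refine ⟨s, s', _, _, hs, hs', hs0, hs0', hα, hβ, ?_, ?_⟩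
  · have a1 := suf_chg_del (N := n + 1) (d := d) (A := A) (by omega) (by omega)
      (hA.supp _ (by omega)) (hA.supp _ (by omega)) (Nat.zero_le _)
    have a2 := suf_chg_del (N := n + 1) (d := d') (A := B) (by omega) (by omega)
      (hB.supp _ (by omega)) (hB.supp _ (by omega)) (Nat.zero_le _)
    rw [if_pos (by omega)] at a1 a2
    linarith
  obtain ⟨m, rfl⟩ : ∃ m, n = m + 1 := ⟨n - 1, by omega⟩
  have hA' := hA.del h.d1 h.dn
  have hB' := hB.del h.d1' h.dn'
  have m1 := mom_chg_del (N := m + 1 + 1) (d := d) (A := A) (by omega) (by omega)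
      (hA.supp _ (by omega)) (hA.supp _ (by omega))
  have m2 := mom_chg_del (N := m + 1 + 1) (d := d') (A := B) (by omega) (by omega)
      (hB.supp _ (by omega)) (hB.supp _ (by omega))
  have s1 := abs_le.1 (hsuf d)
  have s2 : suf (m + 1 + 1) (chg (del B d')) d = ∑ i ∈ Finset.Ico d d', chg (del B d') i +
      suf (m + 1 + 1) (chg (del B d')) d' := by
    rw [suf, suf, ← Finset.sum_Ico_consecutive _ hdd (show d' ≤ m + 1 + 1 by omega)]
  have b2 : ∀ {c : ℤ}, c = 0 ∨ c = 1 → 0 ≤ c ∧ c ≤ 1 := by rintro c (h | h) <;> omega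
  have b3 : ∀ {c : ℤ}, c = 0 ∨ c = 2 → 0 ≤ c ∧ c ≤ 2 := by rintro c (h | h) <;> omega
  -- Below `d'` the deletion affects only the change at `d' - 1`.
  have s3 : |∑ i ∈ Finset.Ico d d', chg (del B d') i - ∑ i ∈ Finset.Ico d d', chg B i| ≤ 1 := by
    rcases hdd.eq_or_lt with hdd | hdd
    · simp [hdd]
    · obtain ⟨c, rfl⟩ : ∃ c, d' = c + 1 := ⟨d' - 1, by omega⟩
      rw [Finset.sum_Ico_succ_top (by omega), Finset.sum_Ico_succ_top (by omega)]
      have : ∑ i ∈ Finset.Ico d c, chg (del B (c + 1)) i = ∑ i ∈ Finset.Ico d c, chg B i := by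
        refine Finset.sum_congr rfl fun i hi => ?_
        have := (Finset.mem_Ico.1 hi).2
        rw [chg, del, del, if_pos (by omega), if_pos (by omega), chg]
      have := b2 (hB.chg_bit c)
      have := b2 (hB'.chg_bit c)
      rw [abs_le]; constructor <;> linarith
  have := b2 (hA.chg_bit d)
  have := b2 (hB.chg_bit d')
  have := b3 hα
  have := b3 hβ
  rw [abs_le] at *
  constructor <;> nlinarith

end

/-! ### Sign changes of the suffix-sum difference, and words that differ only locally -/

section

variable {n : ℕ} {A B : ℕ → ℤ} {d d' e f : ℕ} {σ τ : ℤ}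

theorem Sol.suf_sub_eq (hA : IsWord n A) (hB : IsWord n B) (h : Sol n A B d d' e f σ τ)
    (hdd : d ≤ d') {j : ℕ} (hj : j ≤ n + 1) :
    suf (n + 1) A j - suf (n + 1) B j =
      (if j ≤ (if e < d then e else e + 1) then σ else 0) +
      (if j ≤ (if f < d then f else f + 1) then τ else 0) +
      if j ≤ d then A d - B d' else if j ≤ d' then B (j - 1) - B d' else 0 := by
  have hdn := h.dn
  have hdn' := h.dn'
  have a1 := suf_del (N := n + 1) (d := d) (A := A) (by omega) (hA.supp _ (by omega)) hj
  have a2 := suf_del (N := n + 1) (d := d') (A := B) (by omega) (hB.supp _ (by omega)) hj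
  have a3 := h.suf_sub j
  rcases Nat.lt_or_ge d j with hdj | hdj
  · have a4 := h.eq (j - 1)
    rw [if_neg (by omega)] at a1
    rw [if_neg (show ¬ j ≤ d by omega)]
    have r1 : (if j ≤ (if e < d then e else e + 1) then σ else 0) =
        (if j ≤ e then σ else 0) + if j - 1 = e then σ else 0 := by
      split_ifs <;> omega
    have r2 : (if j ≤ (if f < d then f else f + 1) then τ else 0) =
        (if j ≤ f then τ else 0) + if j - 1 = f then τ else 0 := by
      split_ifs <;> omega
    rw [r1, r2]
    by_cases hj' : j ≤ d'
    · rw [if_pos hj'] at a2 ⊢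
      have : del B d' (j - 1) = B (j - 1) := by rw [del, if_pos (by omega)]
      linarith
    · rw [if_neg hj'] at a2 ⊢
      linarith
  · rw [if_pos hdj] at a1 ⊢
    rw [if_pos (by omega)] at a2
    have r1 : (if j ≤ (if e < d then e else e + 1) then σ else 0) = if j ≤ e then σ else 0 := by
      split_ifs <;> omega
    have r2 : (if j ≤ (if f < d then f else f + 1) then τ else 0) = if j ≤ f then τ else 0 := by
      split_ifs <;> omega
    rw [r1, r2]
    linarith

/-- The differences of suffix sums change their signs at most twice. -/
theorem Sol.exists_signs (hA : IsWord n A) (hB : IsWord n B) (h : Sol n A B d d' e f σ τ)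
    (h0 : suf (n + 1) A 0 = suf (n + 1) B 0) :
    ∃ a b : ℕ, ∃ ε : ℤ, a ≤ b ∧ (ε = 1 ∨ ε = -1) ∧ ∀ j, j ≤ n + 1 →
      ((j ≤ a ∨ b < j) → 0 ≤ ε * (suf (n + 1) A j - suf (n + 1) B j)) ∧
      (a < j → j ≤ b → ε * (suf (n + 1) A j - suf (n + 1) B j) ≤ 0) := by
  wlog hdd : d ≤ d' generalizing A B d d' σ τ
  · obtain ⟨a, b, ε, hab, hε, H⟩ := this hB hA h.symm h0.symm (by omega)
    refine ⟨a, b, -ε, hab, by rcases hε with h | h <;> rw [h] <;> simp, fun j hj => ?_⟩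
    rw [show -ε * (suf (n + 1) A j - suf (n + 1) B j) =
      ε * (suf (n + 1) B j - suf (n + 1) A j) by ring]
    exact H j hj
  have hD := fun {j : ℕ} (hj : j ≤ n + 1) => h.suf_sub_eq hA hB hdd hj
  have hs := hD (Nat.zero_le _)
  simp only [Nat.zero_le, if_true] at hs
  have hs : σ + τ + (A d - B d') = 0 := by linarith
  -- The substituted positions, counted in `A` instead of in the punctured word.
  set ê := if e < d then e else e + 1 with hê
  set f' := if f < d then f else f + 1 with hf'
  have hef : ê < f' := by have := h.ef; rw [hê, hf']; split_ifs <;> omega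
  have hBb := hB.bit
  -- On `(d, d']` the shift contributes `B (j - 1) - B d'`, whose sign is governed by `B d'` alone.
  -- The vanishing total `hs` leaves ten cases, and in each of them the sign breaks can be chosen
  -- among `0`, `ê` and `f'`.
  rcases hA.bit d with hAd | hAd <;> rcases hB.bit d' with hBd | hBd <;>
    rcases h.sig with hσ | hσ | hσ <;> rcases h.tau with hτ | hτ | hτ <;>
    rw [hAd, hBd, hσ, hτ] at hs <;> (try (exfalso; omega)) <;>
    simp only [hAd, hBd, hσ, hτ] at hD
  · refine ⟨0, 0, 1, le_rfl, by simp, fun j hj => ⟨fun _ => ?_, fun _ _ => by omega⟩⟩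
    have := hBb (j - 1)
    rw [hD hj]; split_ifs <;> omega
  · refine ⟨ê, f', 1, hef.le, by simp, fun j hj => ⟨fun _ => ?_, fun _ _ => ?_⟩⟩ <;>
    · have := hBb (j - 1)
      rw [hD hj]; split_ifs <;> omega
  · refine ⟨0, 0, 1, le_rfl, by simp, fun j hj => ⟨fun _ => ?_, fun _ _ => by omega⟩⟩
    have := hBb (j - 1)
    rw [hD hj]; split_ifs <;> omega
  · by_cases hfd : f' ≤ d
    · refine ⟨0, 0, -1, Nat.zero_le _, by simp, fun j hj => ⟨fun _ => ?_, fun _ _ => ?_⟩⟩ <;>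
      · have := hBb (j - 1)
        rw [hD hj]; split_ifs <;> omega
    · refine ⟨0, f', -1, Nat.zero_le _, by simp, fun j hj => ⟨fun _ => ?_, fun _ _ => ?_⟩⟩ <;>
      · have := hBb (j - 1)
        rw [hD hj]; split_ifs <;> omega
  · by_cases hfd : ê ≤ d
    · refine ⟨0, 0, -1, Nat.zero_le _, by simp, fun j hj => ⟨fun _ => ?_, fun _ _ => ?_⟩⟩ <;>
      · have := hBb (j - 1)
        rw [hD hj]; split_ifs <;> omega
    · refine ⟨0, ê, -1, Nat.zero_le _, by simp, fun j hj => ⟨fun _ => ?_, fun _ _ => ?_⟩⟩ <;>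
      · have := hBb (j - 1)
        rw [hD hj]; split_ifs <;> omega
  · by_cases hfd : f' ≤ d
    · refine ⟨0, 0, 1, Nat.zero_le _, by simp, fun j hj => ⟨fun _ => ?_, fun _ _ => ?_⟩⟩ <;>
      · have := hBb (j - 1)
        rw [hD hj]; split_ifs <;> omega
    · refine ⟨0, f', 1, Nat.zero_le _, by simp, fun j hj => ⟨fun _ => ?_, fun _ _ => ?_⟩⟩ <;>
      · have := hBb (j - 1)
        rw [hD hj]; split_ifs <;> omega
  · by_cases hfd : ê ≤ d
    · refine ⟨0, 0, 1, Nat.zero_le _, by simp, fun j hj => ⟨fun _ => ?_, fun _ _ => ?_⟩⟩ <;>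
      · have := hBb (j - 1)
        rw [hD hj]; split_ifs <;> omega
    · refine ⟨0, ê, 1, Nat.zero_le _, by simp, fun j hj => ⟨fun _ => ?_, fun _ _ => ?_⟩⟩ <;>
      · have := hBb (j - 1)
        rw [hD hj]; split_ifs <;> omega
  · refine ⟨0, 0, -1, le_rfl, by simp, fun j hj => ⟨fun _ => ?_, fun _ _ => by omega⟩⟩
    have := hBb (j - 1)
    rw [hD hj]; split_ifs <;> omega
  · refine ⟨0, 0, -1, le_rfl, by simp, fun j hj => ⟨fun _ => ?_, fun _ _ => by omega⟩⟩
    have := hBb (j - 1)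
    rw [hD hj]; split_ifs <;> omega
  · refine ⟨ê, f', -1, hef.le, by simp, fun j hj => ⟨fun _ => ?_, fun _ _ => ?_⟩⟩ <;>
    · have := hBb (j - 1)
      rw [hD hj]; split_ifs <;> omega

theorem suf_congr {N j : ℕ} {a b : ℕ → ℤ} (h : ∀ i, j ≤ i → i < N → a i = b i) :
    suf N a j = suf N b j :=
  Finset.sum_congr rfl fun i hi => h i (Finset.mem_Ico.1 hi).1 (Finset.mem_Ico.1 hi).2

theorem suf_eq_of_agree {s N : ℕ}
    (h0 : suf N A 0 = suf N B 0) (hs : s ≤ N) (h : ∀ i, i < s → A i = B i) :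
    suf N A s = suf N B s := by
  have key : ∀ a : ℕ → ℤ, suf N a 0 = ∑ i ∈ Finset.Ico 0 s, a i + suf N a s := fun a =>
    (Finset.sum_Ico_consecutive a (Nat.zero_le s) hs).symm
  have := Finset.sum_congr (rfl : Finset.Ico 0 s = _) fun i hi => h i (Finset.mem_Ico.1 hi).2
  linarith [key A, key B]

/-- Words with a common neighbour that differ only in a window, and whose first moments of order at
most three over that window are congruent, are equal. -/
theorem Sol.eq_of_local (hA : IsWord n A) (hB : IsWord n B) (h : Sol n A B d d' e f σ τ)
    (h0 : suf (n + 1) A 0 = suf (n + 1) B 0) {s m M : ℕ} (hmM : m ≤ M) (hsm : s + m ≤ n)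
    (hw : ∀ i, A i ≠ B i → s < i ∧ i ≤ s + m)
    (hk : ∀ k < 3, (3 * (M : ℤ) ^ (k + 1)) ∣ ∑ j ∈ Finset.Ico 1 (m + 1),
      (j : ℤ) ^ k * (suf (n + 1) A (s + j) - suf (n + 1) B (s + j))) : A = B := by
  rcases Nat.eq_zero_or_pos m with rfl | hm
  · funext i
    by_contra hne
    have := hw i hne
    omega
  set D : ℕ → ℤ := fun j => suf (n + 1) A j - suf (n + 1) B j with hD
  have hD1 : D (s + 1) = 0 := by
    rw [hD]; dsimp only
    rw [sub_eq_zero]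
    refine suf_eq_of_agree h0 (by omega) fun i hi => ?_
    by_contra hne
    have := hw i hne
    omega
  have hDle : ∀ j, j ≤ n + 1 → |D j| ≤ 3 := fun j hj => h.abs_suf_le hA hB hj
  have hK : ∀ k < 3, ∑ j ∈ Finset.Ico 1 (m + 1), (j : ℤ) ^ k * D (s + j) = 0 := by
    intro k hk3
    refine Int.eq_zero_of_abs_lt_dvd (hk k hk3) ?_
    have hMp : (0 : ℤ) < (M : ℤ) ^ k := by
      have : (0 : ℤ) < M := by exact_mod_cast (by omega : 0 < M)
      positivity
    -- Dropping the vanishing first term leaves `m - 1` terms of size at most `3 * M ^ k`, which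
    -- makes the bound strictly smaller than the modulus.
    rw [Finset.sum_eq_sum_Ico_succ_bot (by omega), hD1, mul_zero, zero_add]
    calc |∑ j ∈ Finset.Ico (1 + 1) (m + 1), (j : ℤ) ^ k * D (s + j)|
        ≤ ∑ j ∈ Finset.Ico (1 + 1) (m + 1), |(j : ℤ) ^ k * D (s + j)| :=
          Finset.abs_sum_le_sum_abs _ _
      _ ≤ ∑ j ∈ Finset.Ico (1 + 1) (m + 1), (M : ℤ) ^ k * 3 := by
          refine Finset.sum_le_sum fun j hj => ?_
          have hj := Finset.mem_Ico.1 hj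
          rw [abs_mul, abs_of_nonneg (by positivity)]
          have : (j : ℤ) ≤ M := by exact_mod_cast (by omega : j ≤ M)
          gcongr
          exact hDle _ (by omega)
      _ = ((m : ℤ) - 1) * ((M : ℤ) ^ k * 3) := by
          rw [Finset.sum_const, Nat.card_Ico, nsmul_eq_mul]
          congr 1
          omega
      _ < 3 * (M : ℤ) ^ (k + 1) := by
          have : (m : ℤ) ≤ M := by exact_mod_cast hmM
          rw [pow_succ]
          nlinarith
  obtain ⟨a, b, ε, hab, hε, hsgn⟩ := h.exists_signs hA hB h0
  -- The roots are at `a + 1/2` and `b + 1/2`: the quadratic never vanishes at an integer, and its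
  -- product with `ε * D` is nonnegative.
  set p : ℕ → ℤ := fun j => (2 * ((s : ℤ) + j) - 2 * a - 1) * (2 * ((s : ℤ) + j) - 2 * b - 1)
    with hp
  have hsum : ∑ j ∈ Finset.Ico 1 (m + 1), ε * (p j * D (s + j)) = 0 := by
    have e0 := hK 0 (by norm_num)
    have e1 := hK 1 (by norm_num)
    have e2 := hK 2 (by norm_num)
    have : ∀ j ∈ Finset.Ico 1 (m + 1), ε * (p j * D (s + j)) =
        ε * ((2 * s - 2 * a - 1) * (2 * s - 2 * b - 1)) * ((j : ℤ) ^ 0 * D (s + j)) +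
        ε * (2 * ((2 * s - 2 * a - 1) + (2 * s - 2 * b - 1))) * ((j : ℤ) ^ 1 * D (s + j)) +
        ε * 4 * ((j : ℤ) ^ 2 * D (s + j)) := by
      intro j _
      rw [hp]; ring
    rw [Finset.sum_congr rfl this, Finset.sum_add_distrib, Finset.sum_add_distrib,
      ← Finset.mul_sum, ← Finset.mul_sum, ← Finset.mul_sum, e0, e1, e2]
    ring
  have hnn : ∀ j ∈ Finset.Ico 1 (m + 1), 0 ≤ ε * (p j * D (s + j)) := by
    intro j hj
    have hj := Finset.mem_Ico.1 hj
    obtain ⟨h1, h2⟩ := hsgn (s + j) (by omega)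
    rw [show ε * (p j * D (s + j)) = p j * (ε * D (s + j)) by ring]
    by_cases hc : s + j ≤ a ∨ b < s + j
    · refine mul_nonneg ?_ (h1 hc)
      rcases hc with hc | hc
      · exact mul_nonneg_of_nonpos_of_nonpos (by omega) (by omega)
      · exact mul_nonneg (by omega) (by omega)
    · refine mul_nonneg_of_nonpos_of_nonpos ?_ (h2 (by omega) (by omega))
      exact mul_nonpos_of_nonneg_of_nonpos (by omega) (by omega)
  have hzero := (Finset.sum_eq_zero_iff_of_nonneg hnn).1 hsum
  have hDz : ∀ j, 1 ≤ j → j ≤ m → D (s + j) = 0 := by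
    intro j h1 h2
    have := hzero j (Finset.mem_Ico.2 ⟨h1, by omega⟩)
    have hε0 : ε ≠ 0 := by rcases hε with h | h <;> rw [h] <;> norm_num
    have hp0 : p j ≠ 0 := mul_ne_zero (by omega) (by omega)
    rcases mul_eq_zero.1 this with h | h
    · exact absurd h hε0
    · exact (mul_eq_zero.1 h).resolve_left hp0
  have hDe : D (s + m + 1) = 0 := by
    rw [hD]; dsimp only
    rw [sub_eq_zero]
    refine suf_congr fun i hi _ => ?_
    by_contra hne
    have := hw i hne
    omega
  funext i
  by_contra hne
  obtain ⟨hi1, hi2⟩ := hw i hne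
  have e1 : D i = 0 := by
    have := hDz (i - s) (by omega) (by omega)
    rwa [show s + (i - s) = i by omega] at this
  have e2 : D (i + 1) = 0 := by
    rcases hi2.eq_or_lt with h | h
    · rw [h]; exact hDe
    · have := hDz (i + 1 - s) (by omega) (by omega)
      rwa [show s + (i + 1 - s) = i + 1 by omega] at this
  have s1 := suf_step (show i < n + 1 by omega) A
  have s2 := suf_step (show i < n + 1 by omega) B
  simp only [hD] at e1 e2
  exact hne (by linarith)

/-! ### Positions of the substitutions relative to the deletions -/

/-- Every long window has between `4/9` and `5/9` of its length as its weight. -/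
def Balanced (l N : ℕ) (a : ℕ → ℤ) : Prop :=
  ∀ i j, 1 ≤ i → i + l ≤ j → j ≤ N →
    4 * ((j : ℤ) - i) ≤ 9 * ∑ k ∈ Finset.Ico i j, a k ∧
      9 * ∑ k ∈ Finset.Ico i j, a k ≤ 5 * ((j : ℤ) - i)

theorem Sol.eq_left (h : Sol n A B d d' e f σ τ) (hdd : d ≤ d') {i : ℕ} (hi : i < d) :
    A i - B i = (if i = e then σ else 0) + if i = f then τ else 0 := by
  have := h.eq i
  rwa [del, del, if_pos hi, if_pos (by omega)] at this

theorem Sol.eq_mid (h : Sol n A B d d' e f σ τ) {i : ℕ} (hi : d ≤ i) (hi' : i < d') :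
    A (i + 1) - B i = (if i = e then σ else 0) + if i = f then τ else 0 := by
  have := h.eq i
  rwa [del, del, if_neg (by omega), if_pos hi'] at this

theorem Sol.eq_right (h : Sol n A B d d' e f σ τ) (hdd : d ≤ d') {i : ℕ} (hi : d' ≤ i) :
    A (i + 1) - B (i + 1) = (if i = e then σ else 0) + if i = f then τ else 0 := by
  have := h.eq i
  rwa [del, del, if_neg (by omega), if_neg (by omega)] at this

theorem Sol.ne_cases (h : Sol n A B d d' e f σ τ) (hdd : d ≤ d') {i : ℕ} (hi : A i ≠ B i) :
    (d ≤ i ∧ i ≤ d') ∨ (σ ≠ 0 ∧ i < d ∧ i = e) ∨ (τ ≠ 0 ∧ i < d ∧ i = f) ∨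
      (σ ≠ 0 ∧ d' < i ∧ i = e + 1) ∨ (τ ≠ 0 ∧ d' < i ∧ i = f + 1) := by
  rcases Nat.lt_or_ge i d with h1 | h1
  · have := h.eq_left hdd h1
    split_ifs at this <;> omega
  rcases Nat.lt_or_ge d' i with h2 | h2
  · have := h.eq_right hdd (i := i - 1) (by omega)
    rw [Nat.sub_add_cancel (by omega)] at this
    split_ifs at this <;> omega
  · exact Or.inl ⟨h1, h2⟩

/-- Let `L = d' - d`. Up to bounded errors, a lone substitution would lie `W ≥ 4L/9` from `d'` or `L
- W ≥ 4L/9` from it by `h3`, but `V / 2 ≤ 5L/18` from `d` or `d'` by `h4`; these are incompatible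
with `W ≤ 5L/9`. No substitution at all is excluded since neither `W` nor `V` is near `0`, `W` is
not near `L`, and `V` is not near `2L`. With two cancelling ones, `f - e` is near `W` or `L - W`,
and `h4` puts one of `e`, `f` about `V / 2` from a deletion. All distances are then at least about
`L / 6`; the bound `l / 10` absorbs the errors. -/
theorem large_gap_arith {d d' e f W V σ τ b b' s s' α β l : ℤ} (hl : 3888 ≤ l)
    (hL : d + l ≤ d') (hef : e < f) (hσ : σ = 0 ∨ σ = 1 ∨ σ = -1) (hτ : τ = 0 ∨ τ = 1 ∨ τ = -1)
    (hb : b = 0 ∨ b = 1) (hb' : b' = 0 ∨ b' = 1)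
    (hs : s = 0 ∨ s = 2 ∨ s = -2) (hs' : s' = 0 ∨ s' = 2 ∨ s' = -2) (hs0 : σ = 0 → s = 0)
    (hs0' : τ = 0 → s' = 0) (hα : α = 0 ∨ α = 2) (hβ : β = 0 ∨ β = 2)
    (h1 : σ + τ + b - b' = 0) (h2 : s + s' + α - β = 0)
    (h3 : |e * σ + f * τ + d * b - d' * b' + W| ≤ 2)
    (h4 : |e * s + f * s' + d * α - d' * β + V| ≤ 12)
    (hW : 4 * (d' - d) ≤ 9 * W ∧ 9 * W ≤ 5 * (d' - d))
    (hV : 4 * (d' - d) ≤ 9 * V ∧ 9 * V ≤ 5 * (d' - d)) :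
    σ + τ = 0 ∧ σ ≠ 0 ∧ f ≤ e + (d' - d) + 2 ∧
      (10 * e + l ≤ 10 * d ∨ 10 * d + l ≤ 10 * e) ∧ (10 * e + l ≤ 10 * d' ∨ 10 * d' + l ≤ 10 * e) ∧
      (10 * f + l ≤ 10 * d ∨ 10 * d + l ≤ 10 * f) ∧ (10 * f + l ≤ 10 * d' ∨ 10 * d' + l ≤ 10 * f) := by
  rw [abs_le] at h3 h4
  rcases hσ with rfl | rfl | rfl <;> rcases hτ with rfl | rfl | rfl <;>
    rcases hb with rfl | rfl <;> rcases hb' with rfl | rfl <;> (try (exfalso; omega)) <;>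
    rcases hα with rfl | rfl <;> rcases hβ with rfl | rfl <;>
    rcases hs with rfl | rfl | rfl <;> (try (exfalso; omega)) <;>
    rcases hs' with rfl | rfl | rfl <;> (try (exfalso; omega)) <;>
    refine ⟨?_, ?_, ?_, ?_, ?_, ?_, ?_⟩ <;> omega

end

/-! ### Far pairs: at most four pairs of punctured words -/

/-- `A` has no window of length more than `t` with period one or two. -/
def PeriodBounded (n t : ℕ) (A : ℕ → ℤ) : Prop :=
  ∀ a b, 1 ≤ a → b ≤ n → (∀ i, a ≤ i → i + 2 ≤ b → A i = A (i + 2)) → b + 1 ≤ a + t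

/-- The properties of two codewords that agree in their global syndromes and differ in two entries
at a distance of at least `4 l`. -/
structure FarPair (n l t : ℕ) (A B : ℕ → ℤ) : Prop where
  hl : 3888 ≤ l
  ht : 1296 * t ≤ l + 5184
  wA : IsWord n A
  wB : IsWord n B
  suf_eq : suf (n + 1) A 0 = suf (n + 1) B 0
  mom_eq : mom (n + 1) A = mom (n + 1) B
  suf_chg_eq : suf (n + 1) (chg A) 0 = suf (n + 1) (chg B) 0
  mom_chg_eq : mom (n + 1) (chg A) = mom (n + 1) (chg B)
  balA : Balanced l (n + 1) A
  balB : Balanced l (n + 1) B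
  bal_chgA : Balanced l (n + 1) (chg A)
  bal_chgB : Balanced l (n + 1) (chg B)
  perA : PeriodBounded n t A
  perB : PeriodBounded n t B
  far : ∃ p q, A p ≠ B p ∧ A q ≠ B q ∧ p + 4 * l ≤ q

/-- The substituted entries compensate each other and are far from the deleted ones. -/
structure Good (r d d' e f : ℕ) (σ τ : ℤ) : Prop where
  sum : σ + τ = 0
  ne : σ ≠ 0
  gap : f ≤ e + (d' - d) + 2
  ed : e + r ≤ d ∨ d + r ≤ e
  ed' : e + r ≤ d' ∨ d' + r ≤ e
  fd : f + r ≤ d ∨ d + r ≤ f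
  fd' : f + r ≤ d' ∨ d' + r ≤ f

/-- Deleting any entry of a run has the same result; this is how different deletion positions are
identified. -/
theorem del_eq_of_const {A : ℕ → ℤ} {d c : ℕ} (hdc : d ≤ c)
    (h : ∀ i, d ≤ i → i < c → A i = A (i + 1)) : del A d = del A c := by
  funext i
  unfold del
  split_ifs with h1 h2 h2
  · rfl
  · omega
  · exact (h i (by omega) h2).symm
  · rfl

/-- Among five consecutive intervals of length `m`, four points miss one. It is applied to the
deletions and substitutions of a second solution. -/
theorem exists_free_interval {S : Finset ℕ} (hS : S.card ≤ 4) (D : ℕ) {m : ℕ} (hm : 0 < m) :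
    ∃ a, D ≤ a ∧ a + m ≤ D + 5 * m ∧ ∀ c ∈ S, c < a ∨ a + m ≤ c := by
  obtain ⟨k, hk, hkS⟩ := Finset.exists_mem_notMem_of_card_lt_card
    (s := S.image fun c => (c - D) / m) (t := Finset.range 5)
    (lt_of_le_of_lt Finset.card_image_le (by simp; omega))
  have hk := Finset.mem_range.1 hk
  refine ⟨D + k * m, by omega, by nlinarith, fun c hc => ?_⟩
  by_contra! hcon
  refine hkS (Finset.mem_image.2 ⟨c, hc, ?_⟩)
  rw [Nat.div_eq_iff hm]
  have h1 : k * m ≤ c - D := by omega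
  have h2 : c - D < k * m + m := by omega
  constructor <;> omega

theorem PeriodBounded.false_of_const {n t a m : ℕ} {A : ℕ → ℤ} (h : PeriodBounded n t A)
    (ha : 1 ≤ a) (hm : a + m ≤ n) (htm : t ≤ m)
    (hc : ∀ i, a ≤ i → i < a + m → A i = A (i + 1)) : False := by
  have := h a (a + m) ha hm fun i h1 h2 => by
    rw [hc i h1 (by omega), hc (i + 1) (by omega) (by omega)]
  omega

section

variable {n l t : ℕ} {A B : ℕ → ℤ} {d d' e f d₂ d₂' e₂ f₂ p q p' q' : ℕ} {σ τ σ₂ τ₂ : ℤ}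

theorem FarPair.symm (h : FarPair n l t A B) : FarPair n l t B A :=
  ⟨h.hl, h.ht, h.wB, h.wA, h.suf_eq.symm, h.mom_eq.symm, h.suf_chg_eq.symm, h.mom_chg_eq.symm,
    h.balB, h.balA, h.bal_chgB, h.bal_chgA, h.perB, h.perA,
    let ⟨p, q, hp, hq, hpq⟩ := h.far; ⟨p, q, hp.symm, hq.symm, hpq⟩⟩

/-- If `d' - d < l`, the first moment places a lone substitution within a bounded distance of `[d,
d']`, and makes two cancelling ones at most `d' - d + 2` apart. Differences `4 l` apart then leave
only a cancelling pair far from the shift. If `d' - d ≥ l`, local balance enters through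
`large_gap_arith`. -/
theorem Sol.good (H : FarPair n l t A B) (h : Sol n A B d d' e f σ τ) (hdd : d ≤ d') :
    Good (l / 10) d d' e f σ τ := by
  have hl := H.hl
  have hd1 := h.d1
  have hdn' := h.dn'
  have hef := h.ef
  obtain ⟨h1, h3⟩ := h.moment_eq H.wA H.wB hdd H.suf_eq H.mom_eq
  rcases Nat.lt_or_ge d' (d + l) with hL | hL
  · obtain ⟨p, q, hp, hq, hpq⟩ := H.far
    have hp := h.ne_cases hdd hp
    have hq := h.ne_cases hdd hq
    have hW0 : 0 ≤ ∑ i ∈ Finset.Ico d d', B i := Finset.sum_nonneg fun i _ => by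
      rcases H.wB.bit i with h | h <;> omega
    have hW1 : ∑ i ∈ Finset.Ico d d', B i ≤ d' - d := by
      refine (Finset.sum_le_card_nsmul _ _ 1 fun i _ => by
        rcases H.wB.bit i with h | h <;> omega).trans ?_
      simp; omega
    rw [abs_le] at h3
    rcases h.sig with hσ | hσ | hσ <;> rcases h.tau with hτ | hτ | hτ <;>
      rcases H.wA.bit d with hb | hb <;> rcases H.wB.bit d' with hb' | hb' <;>
      rw [hσ, hτ, hb, hb'] at h1 h3 <;> (try (exfalso; omega)) <;>
      refine ⟨?_, ?_, ?_, ?_, ?_, ?_, ?_⟩ <;> omega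
  · obtain ⟨s, s', α, β, hs, hs', hs0, hs0', hα, hβ, h2, h4⟩ :=
      h.moment_chg_eq H.wA H.wB hdd H.suf_chg_eq H.mom_chg_eq
    obtain ⟨g1, g2, g3, g4, g5, g6, g7⟩ := large_gap_arith (l := l) (by omega) (by omega)
      (by omega) h.sig h.tau (H.wA.bit d) (H.wB.bit d') hs hs' hs0 hs0' hα hβ h1 h2 h3 h4
      (H.balB d d' hd1 hL (by omega)) (H.bal_chgB d d' hd1 hL (by omega))
    exact ⟨g1, g2, by omega, by omega, by omega, by omega, by omega⟩

theorem Sol.left (h : Sol n A B d d' e f σ τ) (hdd : d ≤ d') {i : ℕ} (hi : i < d) (he : i ≠ e)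
    (hf : i ≠ f) : A i = B i := by
  have := h.eq_left hdd hi
  rw [if_neg he, if_neg hf] at this
  linarith

theorem Sol.mid (h : Sol n A B d d' e f σ τ) {i : ℕ} (hi : d ≤ i) (hi' : i < d') (he : i ≠ e)
    (hf : i ≠ f) : A (i + 1) = B i := by
  have := h.eq_mid hi hi'
  rw [if_neg he, if_neg hf] at this
  linarith

theorem Sol.right (h : Sol n A B d d' e f σ τ) (hdd : d ≤ d') {i : ℕ} (hi : d' ≤ i) (he : i ≠ e)
    (hf : i ≠ f) : A (i + 1) = B (i + 1) := by
  have := h.eq_right hdd hi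
  rw [if_neg he, if_neg hf] at this
  linarith

/-- A shift that is long in one direction excludes the other direction. -/
theorem Sol.false_of_long_of_opposite (H : FarPair n l t A B) (h : Sol n A B d d' e f σ τ)
    (hL : d + l / 10 ≤ d') (h₂ : Sol n B A d₂' d₂ e₂ f₂ σ₂ τ₂) (hdd₂ : d₂' ≤ d₂) : False := by
  have hl := H.hl
  have ht := H.ht
  have hd1 := h.d1
  have hdn' := h.dn'
  have g := h.good H (by omega)
  have := g.ed
  have := g.fd
  obtain ⟨a, ha1, ha2, hfree⟩ := exists_free_interval (S := {d₂', d₂, e₂, f₂})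
    Finset.card_le_four d (m := t + 2) (by omega)
  simp only [Finset.mem_insert, Finset.mem_singleton, forall_eq_or_imp, forall_eq] at hfree
  have hmid : ∀ i, a ≤ i → i < a + (t + 2) → A (i + 1) = B i := fun i h1 h2 =>
    h.mid (by omega) (by omega) (by omega) (by omega)
  by_cases c1 : a + (t + 2) ≤ d₂'
  · refine H.perA.false_of_const (a := a) (m := t + 2) (by omega) (by omega) (by omega)
      fun i h1 h2 => ?_
    rw [hmid i h1 h2, h₂.left hdd₂ (i := i) (by omega) (by omega) (by omega)]
  -- Where the two solutions shift in opposite directions, the shifts compose to a shift of `A` by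
  -- two. To either side, one aligned and one shifted copy make a run.
  by_cases c2 : a + (t + 2) ≤ d₂
  · have := H.perA a (a + (t + 2)) (by omega) (by omega) fun i h1 h2 => by
      rw [hmid (i + 1) (by omega) (by omega),
        h₂.mid (i := i) (by omega) (by omega) (by omega) (by omega)]
    omega
  · refine H.perB.false_of_const (a := a) (m := t + 2) (by omega) (by omega) (by omega)
      fun i h1 h2 => ?_
    rw [← hmid i h1 h2, h₂.right hdd₂ (i := i) (by omega) (by omega) (by omega)]

/-- A long shift meets every other shift in the same direction, on every interval of it that is free
of substitutions. -/
theorem Sol.overlap_of_long (H : FarPair n l t A B) (h : Sol n A B d d' e f σ τ)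
    (h₂ : Sol n A B d₂ d₂' e₂ f₂ σ₂ τ₂) (hdd₂ : d₂ ≤ d₂') {D : ℕ} (hD : d ≤ D)
    (hD' : D + 5 * (t + 2) ≤ d')
    (hfree : ∀ i, D ≤ i → i < D + 5 * (t + 2) → i ≠ e ∧ i ≠ f) :
    d₂ < D + 5 * (t + 2) ∧ D < d₂' := by
  have hd1 := h.d1
  have hdn' := h.dn'
  obtain ⟨a, ha1, ha2, hfree₂⟩ := exists_free_interval (S := {d₂, d₂', e₂, f₂})
    Finset.card_le_four D (m := t + 2) (by omega)
  simp only [Finset.mem_insert, Finset.mem_singleton, forall_eq_or_imp, forall_eq] at hfree₂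
  have hmid : ∀ i, a ≤ i → i < a + (t + 2) → A (i + 1) = B i := fun i h1 h2 =>
    have := hfree i (by omega) (by omega)
    h.mid (by omega) (by omega) this.1 this.2
  by_cases c1 : a + (t + 2) ≤ d₂
  · exact (H.perA.false_of_const (a := a) (m := t + 2) (by omega) (by omega) (by omega)
      fun i h1 h2 => by
        rw [hmid i h1 h2, h₂.left hdd₂ (i := i) (by omega) (by omega) (by omega)]).elim
  by_cases c2 : a + (t + 2) ≤ d₂'
  · omega
  · exact (H.perB.false_of_const (a := a) (m := t + 2) (by omega) (by omega) (by omega)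
      fun i h1 h2 => by
        rw [← hmid i h1 h2, h₂.right hdd₂ (i := i) (by omega) (by omega) (by omega)]).elim

/-- A long shift is the only one in its direction. -/
theorem Sol.del_eq_of_long (H : FarPair n l t A B) (h : Sol n A B d d' e f σ τ)
    (hL : d + l / 10 ≤ d') (h₂ : Sol n A B d₂ d₂' e₂ f₂ σ₂ τ₂) (hdd₂ : d₂ ≤ d₂') :
    del A d₂ = del A d ∧ del B d₂' = del B d' := by
  have hl := H.hl
  have ht := H.ht
  have hd1 := h.d1
  have hdn' := h.dn'
  have hd1₂ := h₂.d1
  have hdn₂' := h₂.dn'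
  have hdd : d ≤ d' := by omega
  obtain ⟨-, -, -, g1, g2, g3, g4⟩ := h.good H hdd
  obtain ⟨-, -, -, k1, k2, k3, k4⟩ := h₂.good H hdd₂
  obtain ⟨o1, o2⟩ := h.overlap_of_long H h₂ hdd₂ (D := d) le_rfl (by omega)
    fun i _ _ => ⟨by omega, by omega⟩
  obtain ⟨o3, o4⟩ := h.overlap_of_long H h₂ hdd₂ (D := d' - 5 * (t + 2)) (by omega) (by omega)
    fun i _ _ => ⟨by omega, by omega⟩
  -- If the second shift began much earlier, `A` would be both aligned with `B` and shifted against
  -- it just before `d`, giving a long run.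
  have o5 : d < d₂ + 5 * (t + 2) := by
    by_contra! hcon
    obtain ⟨a, ha1, ha2, hfree⟩ := exists_free_interval (S := {e₂, f₂})
      (Finset.card_le_two.trans (by norm_num)) (d - 5 * (t + 2)) (m := t + 2) (by omega)
    simp only [Finset.mem_insert, Finset.mem_singleton, forall_eq_or_imp, forall_eq] at hfree
    refine H.perA.false_of_const (a := a) (m := t + 2) (by omega) (by omega) (by omega)
      fun i h1 h2 => ?_
    rw [h.left hdd (i := i) (by omega) (by omega) (by omega),
      h₂.mid (i := i) (by omega) (by omega) (by omega) (by omega)]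
  have o6 : d₂' < d' + 5 * (t + 2) := by
    by_contra! hcon
    obtain ⟨a, ha1, ha2, hfree⟩ := exists_free_interval (S := {e₂, f₂})
      (Finset.card_le_two.trans (by norm_num)) d' (m := t + 2) (by omega)
    simp only [Finset.mem_insert, Finset.mem_singleton, forall_eq_or_imp, forall_eq] at hfree
    refine H.perB.false_of_const (a := a) (m := t + 2) (by omega) (by omega) (by omega)
      fun i h1 h2 => ?_
    rw [← h.right hdd (i := i) (by omega) (by omega) (by omega),
      h₂.mid (i := i) (by omega) (by omega) (by omega) (by omega)]
  -- Corresponding deletions are now closer than `l / 10`, so no substitution lies between them.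
  -- There one solution aligns the words and the other shifts them, hence the entries are constant.
  constructor
  · rcases le_total d d₂ with hc | hc
    · refine (del_eq_of_const hc fun i h1 h2 => ?_).symm
      rw [h.mid (i := i) (by omega) (by omega) (by omega) (by omega),
        h₂.left hdd₂ (i := i) (by omega) (by omega) (by omega)]
    · refine del_eq_of_const hc fun i h1 h2 => ?_
      rw [h₂.mid (i := i) (by omega) (by omega) (by omega) (by omega),
        h.left hdd (i := i) (by omega) (by omega) (by omega)]
  · rcases le_total d' d₂' with hc | hc
    · refine (del_eq_of_const hc fun i h1 h2 => ?_).symm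
      rw [← h.right hdd (i := i) (by omega) (by omega) (by omega),
        h₂.mid (i := i) (by omega) (by omega) (by omega) (by omega)]
    · refine del_eq_of_const hc fun i h1 h2 => ?_
      rw [← h₂.right hdd₂ (i := i) (by omega) (by omega) (by omega),
        h.mid (i := i) (by omega) (by omega) (by omega) (by omega)]

/-- The extreme differences of two sequences, and the extreme ones on either side of a gap. -/
structure Clusters (l : ℕ) (A B : ℕ → ℤ) (p q' p' q : ℕ) : Prop where
  hp : A p ≠ B p
  hq : A q ≠ B q
  hp' : A p' ≠ B p'
  hq' : A q' ≠ B q'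
  pq : p + 4 * l ≤ q
  lt_p' : p + 2 * l < p'
  q'_le : q' ≤ p + 2 * l
  min : ∀ i, i < p → A i = B i
  max : ∀ i, q < i → A i = B i
  max' : ∀ i, q' < i → i ≤ p + 2 * l → A i = B i
  min' : ∀ i, p + 2 * l < i → i < p' → A i = B i

theorem Clusters.symm (h : Clusters l A B p q' p' q) : Clusters l B A p q' p' q :=
  ⟨h.hp.symm, h.hq.symm, h.hp'.symm, h.hq'.symm, h.pq, h.lt_p', h.q'_le,
    fun i h1 => (h.min i h1).symm, fun i h1 => (h.max i h1).symm,
    fun i h1 h2 => (h.max' i h1 h2).symm, fun i h1 h2 => (h.min' i h1 h2).symm⟩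

theorem FarPair.exists_clusters (H : FarPair n l t A B) : ∃ p q' p' q, Clusters l A B p q' p' q := by
  classical
  obtain ⟨p₀, q₀, hp₀, hq₀, hpq₀⟩ := H.far
  have hb : ∀ i, A i ≠ B i → i ≤ n := fun i hi => by
    by_contra hc
    exact hi (by rw [H.wA.supp i (by omega), H.wB.supp i (by omega)])
  have hex : ∃ i, A i ≠ B i := ⟨p₀, hp₀⟩
  set p := Nat.find hex with hp
  have hpp : A p ≠ B p := Nat.find_spec hex
  have hmin : ∀ i, i < p → A i = B i := fun i hi => not_not.1 (Nat.find_min hex hi)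
  have hpp₀ : p ≤ p₀ := Nat.find_min' hex hp₀
  set q := Nat.findGreatest (fun i => A i ≠ B i) n with hq
  have hqq : A q ≠ B q := Nat.findGreatest_spec (P := fun i => A i ≠ B i) (hb _ hq₀) hq₀
  have hq₀q : q₀ ≤ q := Nat.le_findGreatest (hb _ hq₀) hq₀
  have hmax : ∀ i, q < i → A i = B i := fun i hi => by
    by_contra hc
    exact Nat.findGreatest_is_greatest hi (hb _ hc) hc
  set q' := Nat.findGreatest (fun i => A i ≠ B i) (p + 2 * l) with hq'
  have hex' : ∃ i, p + 2 * l < i ∧ A i ≠ B i := ⟨q, by have := H.hl; omega, hqq⟩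
  refine ⟨p, q', Nat.find hex', q, hpp, hqq, (Nat.find_spec hex').2,
    Nat.findGreatest_spec (P := fun i => A i ≠ B i) (m := p) (by omega) hpp, by omega,
    (Nat.find_spec hex').1, Nat.findGreatest_le _, hmin, hmax, fun i h1 h2 => ?_, fun i h1 h2 => ?_⟩
  · by_contra hc
    exact Nat.findGreatest_is_greatest h1 h2 hc
  · by_contra hc
    exact Nat.find_min hex' h2 ⟨h1, hc⟩

/-- The interval of a short shift contains exactly one of the two clusters, the other being due to
the substitutions. Between an end of the interval and the nearest difference of its cluster, the
words are both shifted and equal, hence constant; so the deletions may be moved to the extreme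
differences. -/
theorem Sol.del_eq_of_short (H : FarPair n l t A B) (C : Clusters l A B p q' p' q)
    (h : Sol n A B d d' e f σ τ) (hdd : d ≤ d') (hL : d' < d + l / 10) :
    (del A d = del A p ∧ del B d' = del B q') ∨ (del A d = del A p' ∧ del B d' = del B q) := by
  have hl := H.hl
  obtain ⟨-, -, g0, g1, g2, g3, g4⟩ := h.good H hdd
  have hef := h.ef
  have hpq := C.pq
  have c1 := h.ne_cases hdd C.hp
  have c2 := h.ne_cases hdd C.hq
  have c3 := h.ne_cases hdd C.hp'
  have c4 := h.ne_cases hdd C.hq'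
  have lt_p' := C.lt_p'
  have q'_le := C.q'_le
  have hpq' : p ≤ q' := by
    by_contra! hc
    exact C.hq' (C.min q' hc)
  have hpq'' : p' ≤ q := by
    by_contra! hc
    exact C.hp' (C.max p' hc)
  by_cases hside : d' + l / 10 ≤ e
  · left
    constructor
    · refine del_eq_of_const (by omega) fun i h1 h2 => ?_
      rw [h.mid (i := i) (by omega) (by omega) (by omega) (by omega), C.min i h2]
    · refine (del_eq_of_const (by omega) fun i h1 h2 => ?_).symm
      rw [← C.max' (i + 1) (by omega) (by omega),
        h.mid (i := i) (by omega) (by omega) (by omega) (by omega)]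
  · right
    constructor
    · refine del_eq_of_const (by omega) fun i h1 h2 => ?_
      rw [h.mid (i := i) (by omega) (by omega) (by omega) (by omega), C.min' i (by omega) h2]
    · refine (del_eq_of_const (by omega) fun i h1 h2 => ?_).symm
      rw [← C.max (i + 1) (by omega),
        h.mid (i := i) (by omega) (by omega) (by omega) (by omega)]

/-- Up to equality of the results, there are at most four pairs of deletions. -/
theorem FarPair.exists_four (H : FarPair n l t A B) :
    ∃ c c' : Fin 4 → ℕ, ∀ d d' e f σ τ, Sol n A B d d' e f σ τ →
      ∃ k, del A d = del A (c k) ∧ del B d' = del B (c' k) := by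
  by_cases h1 : ∃ d d' e f σ τ, Sol n A B d d' e f σ τ ∧ d + l / 10 ≤ d'
  · obtain ⟨d, d', e, f, σ, τ, h, hL⟩ := h1
    refine ⟨fun _ => d, fun _ => d', fun d₂ d₂' e₂ f₂ σ₂ τ₂ h₂ => ⟨0, ?_⟩⟩
    rcases le_total d₂ d₂' with hdd | hdd
    · exact h.del_eq_of_long H hL h₂ hdd
    · exact (h.false_of_long_of_opposite H hL h₂.symm hdd).elim
  by_cases h2 : ∃ d d' e f σ τ, Sol n A B d d' e f σ τ ∧ d' + l / 10 ≤ d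
  · obtain ⟨d, d', e, f, σ, τ, h, hL⟩ := h2
    refine ⟨fun _ => d, fun _ => d', fun d₂ d₂' e₂ f₂ σ₂ τ₂ h₂ => ⟨0, ?_⟩⟩
    rcases le_total d₂' d₂ with hdd | hdd
    · exact (h.symm.del_eq_of_long H.symm hL h₂.symm hdd).symm
    · exact (h.symm.false_of_long_of_opposite H.symm hL h₂ hdd).elim
  push Not at h1 h2
  obtain ⟨p, q', p', q, C⟩ := H.exists_clusters
  -- Two clusters for each of the two directions of the shift.
  refine ⟨![p, p', q', q], ![q', q, p, p'], fun d d' e f σ τ h => ?_⟩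
  rcases le_total d d' with hdd | hdd
  · rcases h.del_eq_of_short H C hdd (h1 _ _ _ _ _ _ h) with h | h
    exacts [⟨0, h⟩, ⟨1, h⟩]
  · rcases h.symm.del_eq_of_short H.symm C.symm hdd (h2 _ _ _ _ _ _ h) with h | h
    exacts [⟨2, h.symm⟩, ⟨3, h.symm⟩]

theorem FarPair.del_ne (H : FarPair n l t A B) (h : Sol n A B d d' e f σ τ) :
    del A d ≠ del B d' := by
  have key : σ ≠ 0 := by
    rcases le_total d d' with hdd | hdd
    · exact (h.good H hdd).ne
    · simpa using (h.symm.good H.symm hdd).ne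
  intro heq
  have := h.eq e
  rw [heq, if_pos rfl, if_neg h.ef.ne, sub_self] at this
  exact key (by linarith)

end

/-! ### Block syndromes as moments over windows -/

/-- The window of length `2 P` that starts at the block with index `c + 1`. -/
def win (P : ℕ) (x : List Bool) (c : ℕ) : List Bool := (x.drop (c * P)).take (2 * P)

theorem block_append_block (P : ℕ) (x : List Bool) (c : ℕ) :
    block P x (c + 1) ++ block P x (c + 2) = win P x c := by
  unfold block win
  rw [show c + 1 - 1 = c by omega, show c + 2 - 1 = c + 1 by omega, two_mul, List.take_add,
    List.drop_drop, show c * P + P = (c + 1) * P by ring]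

theorem length_win (P : ℕ) (x : List Bool) (c : ℕ) :
    (win P x c).length = min (2 * P) (x.length - c * P) := by simp [win]

theorem seq_win (P : ℕ) (x : List Bool) (c j : ℕ) (hj : 1 ≤ j) (hj' : j ≤ 2 * P) :
    seq (win P x c) j = seq x (c * P + j) := by
  obtain ⟨j, rfl⟩ : ∃ k, j = k + 1 := ⟨j - 1, by omega⟩
  rw [← add_assoc, seq_succ, seq_succ]
  simp [win, List.getD_eq_getElem?_getD, show j < 2 * P by omega]

theorem win_eq_win {P : ℕ} {x y : List Bool} (hl : x.length = y.length) {c : ℕ}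
    (h : ∀ i, c * P < i → i ≤ c * P + 2 * P → seq x i = seq y i) : win P x c = win P y c := by
  refine seq_injective (by rw [length_win, length_win, hl]) ?_
  funext j
  rcases Nat.eq_zero_or_pos j with rfl | hj
  · rw [(isWord_seq _).zero, (isWord_seq _).zero]
  rcases Nat.lt_or_ge (2 * P) j with hj' | hj'
  · rw [(isWord_seq _).supp j (by rw [length_win]; omega),
      (isWord_seq _).supp j (by rw [length_win]; omega)]
  · rw [seq_win _ _ _ _ hj hj', seq_win _ _ _ _ hj hj', h _ (by omega) (by omega)]

/-- Beyond the window the words agree, so the difference of the suffix sums inside the window equals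
that of the global ones. -/
theorem VT_win_sub {P : ℕ} {x y : List Bool} (hl : x.length = y.length) {c : ℕ}
    (h : ∀ i, seq x i ≠ seq y i → i ≤ c * P + 2 * P) (k : ℕ) :
    (VT (k + 1) (win P x c) : ℤ) - VT (k + 1) (win P y c) =
      ∑ j ∈ Finset.Ico 1 (min (2 * P) (x.length - c * P) + 1), (j : ℤ) ^ k *
        (suf (x.length + 1) (seq x) (c * P + j) - suf (x.length + 1) (seq y) (c * P + j)) := by
  rw [VT_succ_eq, VT_succ_eq, length_win, length_win, ← hl, ← Finset.sum_sub_distrib]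
  set m := min (2 * P) (x.length - c * P) with hm
  refine Finset.sum_congr rfl fun j hj => ?_
  have hj := Finset.mem_Ico.1 hj
  rw [← mul_sub, suf_sub_suf, suf_sub_suf]
  congr 1
  have hcon := Finset.sum_Ico_consecutive (fun i => seq x i - seq y i)
    (show c * P + j ≤ c * P + m + 1 by omega) (show c * P + m + 1 ≤ x.length + 1 by omega)
  have hz : ∑ i ∈ Finset.Ico (c * P + m + 1) (x.length + 1), (seq x i - seq y i) = 0 := by
    refine Finset.sum_eq_zero fun i hi => ?_
    have hi := Finset.mem_Ico.1 hi
    by_contra hne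
    have := h i fun he => hne (by rw [he]; ring)
    omega
  unfold suf
  rw [← hcon, hz, add_zero, show c * P + m + 1 = (m + 1) + c * P by ring,
    show c * P + j = j + c * P by ring, ← Finset.sum_Ico_add' _ j (m + 1) (c * P)]
  refine Finset.sum_congr rfl fun i hi => ?_
  have hi := Finset.mem_Ico.1 hi
  dsimp only
  rw [seq_win _ _ _ _ (by omega) (by omega), seq_win _ _ _ _ (by omega) (by omega),
    add_comm (c * P) i]

theorem oddPairVT_eq (P k : ℕ) (x : List Bool) :
    oddPairVT P k x = ∑ i ∈ Finset.Icc 1 (x.length / P + 1), VT k (win P x (2 * i - 2)) := by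
  refine Finset.sum_congr rfl fun i hi => ?_
  have hi := (Finset.mem_Icc.1 hi).1
  rw [← block_append_block, show 2 * i - 2 + 1 = 2 * i - 1 by omega,
    show 2 * i - 2 + 2 = 2 * i by omega]

theorem evenPairVT_eq (P k : ℕ) (x : List Bool) :
    evenPairVT P k x = ∑ i ∈ Finset.Icc 1 (x.length / P + 1), VT k (win P x (2 * i - 1)) := by
  refine Finset.sum_congr rfl fun i hi => ?_
  have hi := (Finset.mem_Icc.1 hi).1
  rw [← block_append_block, show 2 * i - 1 + 1 = 2 * i by omega,
    show 2 * i - 1 + 2 = 2 * i + 1 by omega]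

/-- If two words differ only in two adjacent blocks, then one of the two families of block
syndromes sees all of their difference. -/
theorem dvd_VT_win_sub {P : ℕ} {x y : List Bool} (hl : x.length = y.length)
    {c : ℕ} (hc : c ≤ x.length / P)
    (h : ∀ i, seq x i ≠ seq y i → c * P < i ∧ i ≤ c * P + 2 * P) {k M : ℕ}
    (ho : oddPairVT P k x ≡ oddPairVT P k y [MOD M])
    (he : evenPairVT P k x ≡ evenPairVT P k y [MOD M]) :
    (M : ℤ) ∣ (VT k (win P x c) : ℤ) - VT k (win P y c) := by
  have hother : ∀ c', c' + 2 ≤ c ∨ c + 2 ≤ c' → win P x c' = win P y c' := fun c' hc' =>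
    win_eq_win hl fun i h1 h2 => by
      by_contra hne
      have := h i hne
      rcases hc' with hc' | hc'
      · have := Nat.mul_le_mul_right P hc'
        rw [add_mul] at this; omega
      · have := Nat.mul_le_mul_right P hc'
        rw [add_mul] at this; omega
  have key : ∀ g : ℕ → ℕ, (∃ i₀ ∈ Finset.Icc 1 (x.length / P + 1), g i₀ = c ∧
      ∀ i ∈ Finset.Icc 1 (x.length / P + 1), i ≠ i₀ → g i + 2 ≤ c ∨ c + 2 ≤ g i) →
      ∑ i ∈ Finset.Icc 1 (x.length / P + 1), VT k (win P x (g i)) ≡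
        ∑ i ∈ Finset.Icc 1 (x.length / P + 1), VT k (win P y (g i)) [MOD M] →
      (M : ℤ) ∣ (VT k (win P x c) : ℤ) - VT k (win P y c) := by
    rintro g ⟨i₀, hi₀, hg, hi⟩ hmod
    have := (Nat.modEq_iff_dvd.1 hmod.symm)
    push_cast at this
    rw [← Finset.sum_sub_distrib, Finset.sum_eq_single i₀, hg] at this
    · exact this
    · intro i h1 h2
      rw [hother _ (hi i h1 h2), sub_self]
    · exact fun h => absurd hi₀ h
  -- The parity of `c` decides which family contains the window; the other windows of that family
  -- are disjoint from it and cancel.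
  rcases Nat.even_or_odd' c with ⟨b, hb | hb⟩
  · rw [oddPairVT_eq, oddPairVT_eq, ← hl] at ho
    refine key (fun i => 2 * i - 2) ⟨b + 1, Finset.mem_Icc.2 ⟨by omega, by omega⟩, by omega, ?_⟩ ho
    intro i hi hne
    have := Finset.mem_Icc.1 hi
    omega
  · rw [evenPairVT_eq, evenPairVT_eq, ← hl] at he
    refine key (fun i => 2 * i - 1) ⟨b + 1, Finset.mem_Icc.2 ⟨by omega, by omega⟩, by omega, ?_⟩ he
    intro i hi hne
    have := Finset.mem_Icc.1 hi
    omega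

/-! ### From codewords to far pairs -/

theorem StrongLocallyBalanced.window {l : ℕ} {x : List Bool}
    (h : StrongLocallyBalanced l (1 / 18) x) {a m : ℕ} (hm : l ≤ m) (ha : a + m ≤ x.length) :
    4 * (m : ℤ) ≤ 9 * ∑ k ∈ Finset.Ico (a + 1) (a + m + 1), seq x k ∧
      9 * ∑ k ∈ Finset.Ico (a + 1) (a + m + 1), seq x k ≤ 5 * (m : ℤ) := by
  obtain ⟨h1, h2⟩ := h a m hm ha
  rw [← wt_drop_take x a m ha]
  constructor
  · have : (4 * m : ℝ) ≤ 9 * (wt ((x.drop a).take m) : ℝ) := by linarith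
    exact_mod_cast this
  · have : (9 * (wt ((x.drop a).take m) : ℝ)) ≤ 5 * m := by linarith
    exact_mod_cast this

theorem StrongLocallyBalanced.balanced {l : ℕ} {x : List Bool}
    (h : StrongLocallyBalanced l (1 / 18) x) : Balanced l (x.length + 1) (seq x) := by
  intro i j hi hij hj
  have := h.window (a := i - 1) (m := j - i) (by omega) (by omega)
  rwa [show i - 1 + 1 = i by omega, show i - 1 + (j - i) + 1 = j by omega,
    Nat.cast_sub (by omega)] at this

theorem StrongLocallyBalanced.balanced_chg {l : ℕ} {x : List Bool}
    (h : StrongLocallyBalanced l (1 / 18) (diffSeq x)) :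
    Balanced l (x.length + 1) (chg (seq x)) := by
  intro i j hi hij hj
  have := h.window (a := i) (m := j - i) (by omega) (by rw [length_diffSeq]; omega)
  rw [show i + (j - i) + 1 = j + 1 by omega, ← Finset.sum_Ico_add' _ i j 1,
    Nat.cast_sub (by omega), Finset.sum_congr rfl fun k _ => seq_diffSeq x k] at this
  exact this

theorem periodBounded_of_mem {n t : ℕ} {x : List Bool} (h : x ∈ boundedPeriodic n 2 t) :
    PeriodBounded n t (seq x) := by
  obtain ⟨hl, h⟩ := h
  intro a b ha hb hper
  rcases Nat.lt_or_ge b a with hab | hab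
  · omega
  set u := (x.drop (a - 1)).take (b + 1 - a) with hu
  have hul : u.length = b + 1 - a := by rw [hu]; simp; omega
  have hget : ∀ i, i < b + 1 - a → u[i]? = x[a - 1 + i]? := fun i hi => by
    rw [hu, List.getElem?_take, if_pos hi, List.getElem?_drop]
  have hinf : List.IsInfix u x := (List.take_prefix _ _).isInfix.trans (List.drop_suffix _ _).isInfix
  have h2 : 2 ∈ {q : ℕ | 0 < q ∧ ∀ i, i + q < u.length → u[i]? = u[i + q]?} := by
    refine ⟨by norm_num, fun i hi => ?_⟩
    rw [hul] at hi
    rw [hget i (by omega), hget (i + 2) hi]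
    have := hper (a + i) (by omega) (by omega)
    rw [show a + i = (a - 1 + i) + 1 by omega,
      show a - 1 + i + 1 + 2 = (a - 1 + (i + 2)) + 1 by omega, seq_succ, seq_succ,
      List.getD_eq_getElem _ _ (by omega), List.getD_eq_getElem _ _ (by omega)] at this
    rw [List.getElem?_eq_getElem (by omega), List.getElem?_eq_getElem (by omega)]
    have hbit : ∀ b c : Bool, ((if b = true then (1 : ℤ) else 0) = if c = true then 1 else 0) →
        b = c := by
      intro b c; cases b <;> cases c <;> simp
    exact congrArg some (hbit _ _ this)
  have hne : {q : ℕ | 0 < q ∧ ∀ i, i + q < u.length → u[i]? = u[i + q]?}.Nonempty := ⟨2, h2⟩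
  -- The period is the least shift, which may be 1 instead of 2.
  have := h u hinf ⟨_, Nat.sInf_le h2, Nat.sInf_mem hne, fun q hq => Nat.sInf_le hq⟩
  omega

theorem three_le_logb {n : ℕ} (hn : 10 ≤ n) : 3 ≤ Real.logb 2 (n : ℝ) := by
  rw [Real.le_logb_iff_rpow_le (by norm_num) (by positivity)]
  have : (10 : ℝ) ≤ n := by exact_mod_cast hn
  norm_num
  linarith

theorem le_winLen {n : ℕ} (hn : 10 ≤ n) : 3888 ≤ winLen n := by
  have h1 := three_le_logb hn
  have h2 : 1296 * Real.logb 2 (n : ℝ) ≤ winLen n := Nat.le_ceil _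
  have : (3888 : ℝ) ≤ winLen n := by linarith
  exact_mod_cast this

theorem period_le_winLen {n : ℕ} (hn : 10 ≤ n) :
    1296 * (⌈Real.logb 2 (n : ℝ)⌉₊ + 3) ≤ winLen n + 5184 := by
  have h1 := three_le_logb hn
  have h2 : 1296 * Real.logb 2 (n : ℝ) ≤ winLen n := Nat.le_ceil _
  have h3 : (⌈Real.logb 2 (n : ℝ)⌉₊ : ℝ) < Real.logb 2 (n : ℝ) + 1 := Nat.ceil_lt_add_one (by linarith)
  have : (1296 * (⌈Real.logb 2 (n : ℝ)⌉₊ + 3) : ℝ) ≤ winLen n + 5184 := by linarith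
  exact_mod_cast this

theorem eq_of_modEq_of_abs_le {a b m : ℕ} {c : ℤ} (hc : |(a : ℤ) - b| ≤ c) (hcm : c < m)
    (h : a ≡ b [MOD m]) : (a : ℤ) = b := by
  have h1 := Nat.modEq_iff_dvd.1 h.symm
  have := Int.eq_zero_of_abs_lt_dvd h1 (lt_of_le_of_lt hc hcm)
  linarith

theorem abs_sum_le {s : Finset ℕ} {f : ℕ → ℤ} {c : ℤ} (h : ∀ i ∈ s, |f i| ≤ c) :
    |∑ i ∈ s, f i| ≤ s.card * c := by
  refine (Finset.abs_sum_le_sum_abs _ _).trans ?_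
  refine (Finset.sum_le_card_nsmul _ _ _ h).trans ?_
  simp

theorem farPair_of_mem_code {n : ℕ} (hn : 10 ≤ n) {p : Params} {x y : List Bool}
    (hx : x ∈ code n p) (hy : y ∈ code n p) (hxy : x ≠ y)
    (hsol : ∃ d d' e f σ τ, Sol n (seq x) (seq y) d d' e f σ τ) :
    FarPair n (winLen n) (⌈Real.logb 2 (n : ℝ)⌉₊ + 3) (seq x) (seq y) := by
  obtain ⟨⟨hxl, hxb, hxb'⟩, hxR, hx0, hx1, hx2, hx3, hx4⟩ := hx
  obtain ⟨⟨hyl, hyb, hyb'⟩, hyR, hy0, hy1, hy2, hy3, hy4⟩ := hy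
  obtain ⟨d, d', e, f, σ, τ, hS⟩ := hsol
  have hlen : x.length = y.length := by rw [hxl, hyl]
  have wA : IsWord n (seq x) := hxl ▸ isWord_seq x
  have wB : IsWord n (seq y) := hyl ▸ isWord_seq y
  have e0 : suf (n + 1) (seq x) 0 = suf (n + 1) (seq y) 0 := by
    have := hS.abs_suf_le wA wB (Nat.zero_le _)
    have := eq_of_modEq_of_abs_le (c := 3)
      (by rw [VT_zero_eq, VT_zero_eq, hxl, hyl]; exact this) (by norm_num) (hx0.trans hy0.symm)
    rwa [VT_zero_eq, VT_zero_eq, hxl, hyl] at this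
  have e1 : mom (n + 1) (seq x) = mom (n + 1) (seq y) := by
    have hb : |mom (n + 1) (seq x) - mom (n + 1) (seq y)| ≤ n * 3 := by
      rw [← sum_suf_eq, ← sum_suf_eq, ← Finset.sum_sub_distrib]
      refine (abs_sum_le fun j hj => hS.abs_suf_le wA wB (Finset.mem_Ico.1 hj).2.le).trans ?_
      simp
    have := eq_of_modEq_of_abs_le (c := n * 3)
      (by rw [VT_one_eq, VT_one_eq, hxl, hyl]; exact hb) (by push_cast; linarith)
      (hx1.trans hy1.symm)
    rwa [VT_one_eq, VT_one_eq, hxl, hyl] at this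
  have e2 : suf (n + 1) (chg (seq x)) 0 = suf (n + 1) (chg (seq y)) 0 := by
    have := hS.abs_suf_chg_le wA wB (Nat.zero_le _)
    have := eq_of_modEq_of_abs_le (c := 6)
      (by rw [VT_zero_diffSeq, VT_zero_diffSeq, hxl, hyl]; exact this) (by norm_num)
      (hx2.trans hy2.symm)
    rwa [VT_zero_diffSeq, VT_zero_diffSeq, hxl, hyl] at this
  have e3 : mom (n + 1) (chg (seq x)) = mom (n + 1) (chg (seq y)) := by
    have hb : |∑ j ∈ Finset.range (n + 1), suf (n + 1) (chg (seq x)) j -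
        ∑ j ∈ Finset.range (n + 1), suf (n + 1) (chg (seq y)) j| ≤ (n + 1) * 6 := by
      rw [← Finset.sum_sub_distrib]
      refine (abs_sum_le fun j hj => hS.abs_suf_chg_le wA wB (Finset.mem_range.1 hj).le).trans ?_
      simp
    have := eq_of_modEq_of_abs_le (c := (n + 1) * 6)
      (by rw [VT_one_diffSeq, VT_one_diffSeq, hxl, hyl]; exact hb) (by push_cast; linarith)
      (hx3.trans hy3.symm)
    -- The differential syndrome also contains the suffix sum at 0, which agrees for both words by
    -- `e2`.
    have hbot : ∀ g : ℕ → ℤ, ∑ j ∈ Finset.range (n + 1), g j =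
        g 0 + ∑ j ∈ Finset.Ico 1 (n + 1), g j := fun g => by
      rw [Finset.range_eq_Ico, Finset.sum_eq_sum_Ico_succ_bot (by omega)]
    rw [VT_one_diffSeq, VT_one_diffSeq, hxl, hyl, hbot, hbot, sum_suf_eq, sum_suf_eq] at this
    linarith
  refine ⟨le_winLen hn, period_le_winLen hn, wA, wB, e0, e1, e2, e3, hxl ▸ hxb.balanced,
    hyl ▸ hyb.balanced, hxl ▸ hxb'.balanced_chg, hyl ▸ hyb'.balanced_chg, periodBounded_of_mem hxR,
    periodBounded_of_mem hyR, ?_⟩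
  -- Otherwise every difference is less than `P = 4 l` beyond the first one, so all lie in the block
  -- of the first difference and the next block.
  by_contra! hnear
  refine hxy (seq_injective hlen ?_)
  classical
  by_contra hne
  have hex : ∃ i, seq x i ≠ seq y i := Function.ne_iff.1 hne
  set a := Nat.find hex with ha
  have haa : seq x a ≠ seq y a := Nat.find_spec hex
  have hmin : ∀ i, seq x i ≠ seq y i → a ≤ i := fun i hi => Nat.find_min' hex hi
  have hb : ∀ i, seq x i ≠ seq y i → 1 ≤ i ∧ i ≤ n := fun i hi => by
    constructor
    · by_contra hc
      obtain rfl : i = 0 := by omega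
      exact hi (by rw [wA.zero, wB.zero])
    · by_contra hc
      exact hi (by rw [wA.supp i (by omega), wB.supp i (by omega)])
  set P := blockLen n with hP
  have hPpos : 0 < P := by have := le_winLen hn; rw [hP, blockLen]; omega
  have hP4 : P = 4 * winLen n := rfl
  set c := (a - 1) / P with hc
  have hc1 : c * P ≤ a - 1 := Nat.div_mul_le_self _ _
  have hc2 : a - 1 < c * P + P := by
    have := Nat.lt_div_mul_add (a := a - 1) hPpos
    rwa [← hc] at this
  have ha1 := hb a haa
  have hwin : ∀ i, seq x i ≠ seq y i → c * P < i ∧ i ≤ c * P + 2 * P := fun i hi => by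
    have := hnear a i haa hi
    have := hmin i hi
    omega
  have hcn : c ≤ x.length / P := Nat.div_le_div_right (by omega)
  refine hne (hS.eq_of_local wA wB e0 (s := c * P) (m := min (2 * P) (n - c * P)) (M := 2 * P)
    (min_le_left _ _) (by omega) (fun i hi => ?_) fun k hk => ?_)
  · have := hwin i hi
    have := hb i hi
    omega
  · have := dvd_VT_win_sub hlen hcn hwin ((hx4 ⟨k, hk⟩).1.trans (hy4 ⟨k, hk⟩).1.symm)
      ((hx4 ⟨k, hk⟩).2.trans (hy4 ⟨k, hk⟩).2.symm)
    rw [VT_win_sub hlen fun i hi => (hwin i hi).2, hxl] at this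
    push_cast at this
    exact this

/-! ### Counting common neighbours -/

/-- Two distinct words have at most two common words at Hamming distance at most one. -/
theorem encard_near_le_two (m : ℕ) {u v : ℕ → ℤ} (huv : u ≠ v) :
    {z : List Bool | z.length = m ∧ (∃ e, ∀ i, i ≠ e → seq z i = u i) ∧
      ∃ f, ∀ i, i ≠ f → seq z i = v i}.encard ≤ 2 := by
  obtain ⟨k, hk⟩ := Function.ne_iff.1 huv
  -- At `k` a common neighbour disagrees with `u` or with `v`, and so equals that word elsewhere.
  -- Its bit at `k` therefore determines it.
  have hinj : Set.InjOn (fun z : List Bool => (false :: z).getD k false)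
      {z : List Bool | z.length = m ∧ (∃ e, ∀ i, i ≠ e → seq z i = u i) ∧
        ∃ f, ∀ i, i ≠ f → seq z i = v i} := by
    rintro z ⟨hz, ⟨e, he⟩, f, hf⟩ w ⟨hw, ⟨e', he'⟩, f', hf'⟩ hzw
    have hk' : seq z k = seq w k := by unfold seq; dsimp only at hzw; rw [hzw]
    refine seq_injective (by rw [hz, hw]) ?_
    funext i
    by_cases hi : i = k
    · rw [hi, hk']
    by_cases hu : seq z k = u k
    · have hv : seq z k ≠ v k := fun h => hk (hu.symm.trans h)
      have h1 : f = k := by by_contra h; exact hv (hf k (Ne.symm h))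
      have h2 : f' = k := by by_contra h; exact hv (hk' ▸ hf' k (Ne.symm h))
      rw [hf i (by rwa [h1]), hf' i (by rwa [h2])]
    · have h1 : e = k := by by_contra h; exact hu (he k (Ne.symm h))
      have h2 : e' = k := by by_contra h; exact hu (hk' ▸ he' k (Ne.symm h))
      rw [he i (by rwa [h1]), he' i (by rwa [h2])]
  rw [← hinj.encard_image]
  refine (Set.encard_le_encard (Set.subset_univ _)).trans ?_
  rw [Set.encard_univ]
  simp

theorem isReconstructionCode_code {n : ℕ} (hn : 10 ≤ n) (p : Params) :
    IsReconstructionCode n 9 (code n p) := by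
  refine ⟨fun x hx => hx.1.1, fun x hx y hy hxy => ?_⟩
  have hxl : x.length = n := hx.1.1
  have hyl : y.length = n := hy.1.1
  have wA : IsWord n (seq x) := hxl ▸ isWord_seq x
  have wB : IsWord n (seq y) := hyl ▸ isWord_seq y
  have hmem : ∀ z ∈ ball x ∩ ball y, z.length = n - 1 ∧ ∃ d d', (∃ e f σ τ,
      Sol n (seq x) (seq y) d d' e f σ τ) ∧ (∃ e, ∀ i, i ≠ e → seq z i = del (seq x) d i) ∧
        ∃ f, ∀ i, i ≠ f → seq z i = del (seq y) d' i := by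
    rintro z ⟨hzx, hzy⟩
    obtain ⟨hz, d, h1, h2, e, he⟩ := exists_of_mem_ball hzx
    obtain ⟨_, d', h1', h2', f, hf⟩ := exists_of_mem_ball hzy
    exact ⟨by omega, d, d', exists_sol (by omega) wA wB h1 (by omega) h1' (by omega) he hf,
      ⟨e, he⟩, f, hf⟩
  rcases (ball x ∩ ball y).eq_empty_or_nonempty with hemp | ⟨z₀, hz₀⟩
  · rw [hemp]; simp
  have H : FarPair n (winLen n) (⌈Real.logb 2 (n : ℝ)⌉₊ + 3) (seq x) (seq y) := by
    obtain ⟨_, d, d', ⟨e, f, σ, τ, h⟩, _⟩ := hmem z₀ hz₀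
    exact farPair_of_mem_code hn hx hy hxy ⟨d, d', e, f, σ, τ, h⟩
  obtain ⟨c, c', hc⟩ := H.exists_four
  -- Including the inequality in the set makes it empty for a pair of coinciding punctured words;
  -- `FarPair.del_ne` shows that no common neighbour is lost.
  set F : Fin 4 → Set (List Bool) := fun k => {z | del (seq x) (c k) ≠ del (seq y) (c' k) ∧
    z.length = n - 1 ∧ (∃ e, ∀ i, i ≠ e → seq z i = del (seq x) (c k) i) ∧
      ∃ f, ∀ i, i ≠ f → seq z i = del (seq y) (c' k) i} with hF
  have hFle : ∀ k, (F k).encard ≤ 2 := fun k => by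
    by_cases h : del (seq x) (c k) ≠ del (seq y) (c' k)
    · exact (Set.encard_le_encard fun z hz => hz.2).trans (encard_near_le_two (n - 1) h)
    · have : F k = ∅ := Set.eq_empty_of_forall_notMem fun z hz => h hz.1
      rw [this]; simp
  have hsub : ball x ∩ ball y ⊆ F 0 ∪ F 1 ∪ (F 2 ∪ F 3) := by
    intro z hz
    obtain ⟨hzl, d, d', ⟨e, f, σ, τ, h⟩, he, hf⟩ := hmem z hz
    obtain ⟨k, hk, hk'⟩ := hc d d' e f σ τ h
    have : z ∈ F k := ⟨hk ▸ hk' ▸ H.del_ne h, hzl, hk ▸ he, hk' ▸ hf⟩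
    fin_cases k
    · exact Or.inl (Or.inl this)
    · exact Or.inl (Or.inr this)
    · exact Or.inr (Or.inl this)
    · exact Or.inr (Or.inr this)
  have h8 : (ball x ∩ ball y).encard ≤ 2 + 2 + (2 + 2) :=
    (Set.encard_le_encard hsub).trans <| (Set.encard_union_le _ _).trans <| add_le_add
      ((Set.encard_union_le _ _).trans (add_le_add (hFle 0) (hFle 1)))
      ((Set.encard_union_le _ _).trans (add_le_add (hFle 2) (hFle 3)))
  refine lt_of_le_of_lt h8 ?_
  norm_num

/-! ### Counting the words that satisfy the constraints without residues -/

/-- All words of length `n`. -/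
noncomputable def words (n : ℕ) : Finset (List Bool) := (List.finite_length_eq Bool n).toFinset

theorem mem_words {n : ℕ} {x : List Bool} : x ∈ words n ↔ x.length = n := by simp [words]

theorem sum_words_succ (n : ℕ) (g : List Bool → ℝ) :
    ∑ u ∈ words (n + 1), g u = ∑ u ∈ words n, (g (false :: u) + g (true :: u)) := by
  classical
  have hdis : Disjoint ((words n).image (List.cons false)) ((words n).image (List.cons true)) := by
    rw [Finset.disjoint_left]
    intro x h1 h2
    obtain ⟨u, _, rfl⟩ := Finset.mem_image.1 h1
    obtain ⟨v, _, h⟩ := Finset.mem_image.1 h2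
    simp at h
  have heq : words (n + 1) =
      (words n).image (List.cons false) ∪ (words n).image (List.cons true) := by
    ext x
    simp only [Finset.mem_union, Finset.mem_image, mem_words]
    constructor
    · intro hx
      match x, hx with
      | false :: u, hx => exact Or.inl ⟨u, by simpa using hx, rfl⟩
      | true :: u, hx => exact Or.inr ⟨u, by simpa using hx, rfl⟩
    · rintro (⟨u, hu, rfl⟩ | ⟨u, hu, rfl⟩) <;> simp [hu]
  rw [heq, Finset.sum_union hdis, Finset.sum_image (by simp), Finset.sum_image (by simp),
    Finset.sum_add_distrib]

theorem sum_pow_wt (n : ℕ) (c : ℝ) : ∑ u ∈ words n, c ^ wt u = (1 + c) ^ n := by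
  induction n with
  | zero =>
    have : words 0 = {[]} := by ext x; simp [mem_words]
    rw [this]; simp [wt]
  | succ n ih =>
    rw [sum_words_succ, pow_succ, ← ih, Finset.sum_mul]
    refine Finset.sum_congr rfl fun u _ => ?_
    simp only [wt, List.count_cons_self, pow_succ,
      List.count_cons_of_ne (show (false : Bool) ≠ true by simp)]
    ring

theorem card_words (n : ℕ) : ((words n).card : ℝ) = 2 ^ n := by
  have := sum_pow_wt n 1
  norm_num at this
  exact_mod_cast this

/-- The words of length `n` with a given property of the window of length `m` after `i`. -/
theorem card_filter_window_le (Q : List Bool → Prop) [DecidablePred Q] {n i m : ℕ}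
    (h : i + m ≤ n) :
    (((words n).filter fun x => Q ((x.drop i).take m)).card : ℝ) ≤
      2 ^ (n - m) * ((words m).filter Q).card := by
  rw [← card_words, ← Nat.cast_mul, ← Finset.card_product]
  refine Nat.cast_le.2 (Finset.card_le_card_of_injOn
    (fun x => (x.take i ++ x.drop (i + m), (x.drop i).take m)) ?_ ?_)
  · intro x hx
    obtain ⟨hx, hQ⟩ := Finset.mem_filter.1 hx
    rw [mem_words] at hx
    simp only [Finset.coe_product, Set.mem_prod, Finset.mem_coe, Finset.mem_filter, mem_words]
    refine ⟨by simp; omega, by simp; omega, hQ⟩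
  · intro x hx y hy hxy
    have hx := mem_words.1 (Finset.mem_filter.1 hx).1
    have hy := mem_words.1 (Finset.mem_filter.1 hy).1
    obtain ⟨h1, h2⟩ := Prod.mk.inj hxy
    obtain ⟨h3, h4⟩ := List.append_inj h1 (by simp; omega)
    rw [← List.take_append_drop i x, ← List.take_append_drop i y, h3,
      ← List.take_append_drop m (x.drop i), ← List.take_append_drop m (y.drop i), h2,
      List.drop_drop, List.drop_drop, h4]

/-- A bound for the exponential rate of the words with weight off by a factor `1 ± 1/9`. -/
theorem card_filter_wt_le (m : ℕ) :
    (((words m).filter fun u => ¬ (4 * m ≤ 9 * wt u ∧ 9 * wt u ≤ 5 * m)).card : ℝ) ≤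
      2 * (2 * (994 / 1000)) ^ m := by
  classical
  -- A Chernoff bound: a heavy word has `μ ^ (9 * wt u) ≥ μ ^ (5 * m)`. For light words `μ⁻¹` plays
  -- the same role and, by symmetry, yields the same rate.
  set μ : ℝ := 41 / 40 with hμ
  have hrate : ((1 + μ ^ 9) / μ ^ 5) ^ m ≤ (2 * (994 / 1000)) ^ m := by
    gcongr
    rw [hμ]; norm_num
  have hheavy : (((words m).filter fun u => 5 * m < 9 * wt u).card : ℝ) ≤
      ((1 + μ ^ 9) / μ ^ 5) ^ m := by
    rw [div_pow, le_div_iff₀ (by positivity), ← sum_pow_wt, ← nsmul_eq_mul]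
    refine (Finset.card_nsmul_le_sum _ (fun u => (μ ^ 9) ^ wt u) _ fun u hu => ?_).trans
      (Finset.sum_le_sum_of_subset_of_nonneg (Finset.filter_subset _ _) fun u _ _ => by positivity)
    rw [← pow_mul, ← pow_mul]
    exact pow_le_pow_right₀ (by rw [hμ]; norm_num) (Finset.mem_filter.1 hu).2.le
  have hlight : (((words m).filter fun u => 9 * wt u < 4 * m).card : ℝ) ≤
      ((1 + μ ^ 9) / μ ^ 5) ^ m := by
    have : (1 + μ ^ 9) / μ ^ 5 = (1 + μ⁻¹ ^ 9) / μ⁻¹ ^ 4 := by rw [hμ]; norm_num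
    rw [this, div_pow, le_div_iff₀ (by positivity), ← sum_pow_wt, ← nsmul_eq_mul]
    refine (Finset.card_nsmul_le_sum _ (fun u => (μ⁻¹ ^ 9) ^ wt u) _ fun u hu => ?_).trans
      (Finset.sum_le_sum_of_subset_of_nonneg (Finset.filter_subset _ _) fun u _ _ => by positivity)
    rw [← pow_mul, ← pow_mul]
    exact pow_le_pow_of_le_one (by positivity) (by rw [hμ]; norm_num) (Finset.mem_filter.1 hu).2.le
  have hsub : ((words m).filter fun u => ¬ (4 * m ≤ 9 * wt u ∧ 9 * wt u ≤ 5 * m)) ⊆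
      ((words m).filter fun u => 5 * m < 9 * wt u) ∪
        ((words m).filter fun u => 9 * wt u < 4 * m) := by
    intro u hu
    simp only [Finset.mem_union, Finset.mem_filter] at *
    obtain ⟨h1, h2⟩ := hu
    by_cases h : 5 * m < 9 * wt u
    · exact Or.inl ⟨h1, h⟩
    · exact Or.inr ⟨h1, by omega⟩
  have hcard : (((words m).filter fun u => ¬ (4 * m ≤ 9 * wt u ∧ 9 * wt u ≤ 5 * m)).card : ℝ) ≤
      ((words m).filter fun u => 5 * m < 9 * wt u).card +
        ((words m).filter fun u => 9 * wt u < 4 * m).card := by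
    exact_mod_cast (Finset.card_le_card hsub).trans (Finset.card_union_le _ _)
  linarith

-- A union bound over starting points and lengths of windows; since the rate is below 1, the
-- shortest admissible length `l` is the worst.
open scoped Classical in
theorem card_not_balanced_le (N l : ℕ) :
    (((words N).filter fun x => ¬ StrongLocallyBalanced l (1 / 18) x).card : ℝ) ≤
      (N + 1) ^ 2 * (2 ^ N * (2 * (994 / 1000) ^ l)) := by
  set T := ((Finset.range (N + 1)) ×ˢ (Finset.range (N + 1))).filter
    fun p : ℕ × ℕ => l ≤ p.2 ∧ p.1 + p.2 ≤ N with hT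
  set F : ℕ × ℕ → Finset (List Bool) := fun p => (words N).filter fun x =>
    ¬ (4 * p.2 ≤ 9 * wt ((x.drop p.1).take p.2) ∧ 9 * wt ((x.drop p.1).take p.2) ≤ 5 * p.2) with hF
  have hsub : ((words N).filter fun x => ¬ StrongLocallyBalanced l (1 / 18) x) ⊆ T.biUnion F := by
    intro x hx
    obtain ⟨hx, hb⟩ := Finset.mem_filter.1 hx
    unfold StrongLocallyBalanced at hb
    push Not at hb
    obtain ⟨i, m, hm, him, hb⟩ := hb
    rw [mem_words.1 hx] at him
    refine Finset.mem_biUnion.2 ⟨(i, m), ?_, ?_⟩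
    · simp only [hT, Finset.mem_filter, Finset.mem_product, Finset.mem_range]
      omega
    · refine Finset.mem_filter.2 ⟨hx, fun ⟨h1, h2⟩ => ?_⟩
      have h1 : (4 * m : ℝ) ≤ 9 * wt ((x.drop i).take m) := by exact_mod_cast h1
      have h2 : (9 * wt ((x.drop i).take m) : ℝ) ≤ 5 * m := by exact_mod_cast h2
      have := hb (by linarith)
      linarith
  have hFle : ∀ p ∈ T, ((F p).card : ℝ) ≤ 2 ^ N * (2 * (994 / 1000) ^ l) := by
    rintro ⟨i, m⟩ hp
    simp only [hT, Finset.mem_filter, Finset.mem_product, Finset.mem_range] at hp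
    obtain ⟨_, hm, him⟩ := hp
    calc ((F (i, m)).card : ℝ) ≤ 2 ^ (N - m) * (2 * (2 * (994 / 1000)) ^ m) :=
          (card_filter_window_le (fun u => ¬ (4 * m ≤ 9 * wt u ∧ 9 * wt u ≤ 5 * m)) him).trans
            (by gcongr; exact card_filter_wt_le m)
      _ = 2 ^ N * (2 * (994 / 1000) ^ m) := by
          rw [mul_pow, show N = (N - m) + m by omega, pow_add]; simp; ring
      _ ≤ 2 ^ N * (2 * (994 / 1000) ^ l) := by
          gcongr 2 ^ N * (2 * ?_)
          exact pow_le_pow_of_le_one (by norm_num) (by norm_num) hm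
  have hTcard : (T.card : ℝ) ≤ (N + 1) ^ 2 := by
    have : T.card ≤ (N + 1) ^ 2 := by
      refine (Finset.card_filter_le _ _).trans ?_
      simp [sq]
    exact_mod_cast this
  calc (((words N).filter fun x => ¬ StrongLocallyBalanced l (1 / 18) x).card : ℝ)
      ≤ ((T.biUnion F).card : ℝ) := by exact_mod_cast Finset.card_le_card hsub
    _ ≤ ∑ p ∈ T, ((F p).card : ℝ) := by exact_mod_cast Finset.card_biUnion_le
    _ ≤ T.card • (2 ^ N * (2 * (994 / 1000) ^ l)) := Finset.sum_le_card_nsmul _ _ _ hFle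
    _ ≤ (N + 1) ^ 2 * (2 ^ N * (2 * (994 / 1000) ^ l)) := by
        rw [nsmul_eq_mul]; gcongr

theorem diffSeq_injective : Function.Injective diffSeq := by
  intro x y h
  have hl : x.length = y.length := by
    have := congrArg List.length h
    rw [length_diffSeq, length_diffSeq] at this
    omega
  refine seq_injective hl (funext fun i => ?_)
  induction i with
  | zero => rw [(isWord_seq x).zero, (isWord_seq y).zero]
  | succ i ih =>
    have h1 := seq_diffSeq x i
    rw [h, seq_diffSeq y i, chg, chg, ih] at h1
    rcases (isWord_seq y).bit i with a | a <;> rcases (isWord_seq x).bit (i + 1) with b | b <;>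
      rcases (isWord_seq y).bit (i + 1) with c | c <;> rw [a, b, c] at h1 <;> simp_all

open scoped Classical in
theorem card_not_balanced_diffSeq_le (n l : ℕ) :
    (((words n).filter fun x => ¬ StrongLocallyBalanced l (1 / 18) (diffSeq x)).card : ℝ) ≤
      ((n + 1 : ℕ) + 1) ^ 2 * (2 ^ (n + 1) * (2 * (994 / 1000) ^ l)) := by
  refine le_trans ?_ (card_not_balanced_le (n + 1) l)
  refine Nat.cast_le.2 (Finset.card_le_card_of_injOn diffSeq ?_ diffSeq_injective.injOn)
  intro x hx
  obtain ⟨hx, hb⟩ := Finset.mem_filter.1 hx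
  refine Finset.mem_coe.2 (Finset.mem_filter.2 ⟨?_, hb⟩)
  rw [mem_words, length_diffSeq, mem_words.1 hx]

-- The first two entries determine such a word.
open scoped Classical in
theorem card_period_two_le (m : ℕ) :
    ((words m).filter fun u => ∀ i, i + 2 < u.length → u[i]? = u[i + 2]?).card ≤ 4 := by
  refine (Finset.card_le_card_of_injOn (t := (Finset.univ : Finset (Bool × Bool)))
    (fun u => (u.getD 0 false, u.getD 1 false)) (fun _ _ => Finset.mem_coe.2 (Finset.mem_univ _))
      ?_).trans (by simp)
  intro u hu v hv huv
  obtain ⟨hu, hpu⟩ := Finset.mem_filter.1 hu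
  obtain ⟨hv, hpv⟩ := Finset.mem_filter.1 hv
  rw [mem_words] at hu hv
  obtain ⟨h0, h1⟩ := Prod.mk.inj huv
  refine List.ext_getElem? fun i => ?_
  induction i using Nat.twoStepInduction with
  | zero =>
    rcases Nat.eq_zero_or_pos m with h | h
    · rw [List.getElem?_eq_none (by omega), List.getElem?_eq_none (by omega)]
    · rw [List.getD_eq_getElem _ _ (by omega), List.getD_eq_getElem _ _ (by omega)] at h0
      rw [List.getElem?_eq_getElem (by omega), List.getElem?_eq_getElem (by omega), h0]
  | one =>
    rcases Nat.lt_or_ge 1 m with h | h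
    · rw [List.getD_eq_getElem _ _ (by omega), List.getD_eq_getElem _ _ (by omega)] at h1
      rw [List.getElem?_eq_getElem (by omega), List.getElem?_eq_getElem (by omega), h1]
    · rw [List.getElem?_eq_none (by omega), List.getElem?_eq_none (by omega)]
  | more i ih _ =>
    rcases Nat.lt_or_ge (i + 2) m with h | h
    · rw [← hpu i (by omega), ← hpv i (by omega), ih]
    · rw [List.getElem?_eq_none (by omega), List.getElem?_eq_none (by omega)]

theorem shift_two_of_hasPeriod {u : List Bool} {p : ℕ} (hp : p ≤ 2) (h : HasPeriod u p) :
    ∀ i, i + 2 < u.length → u[i]? = u[i + 2]? := by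
  obtain ⟨⟨hp0, h⟩, _⟩ := h
  intro i hi
  obtain rfl | rfl : p = 1 ∨ p = 2 := by omega
  · rw [h i (by omega), h (i + 1) (by omega)]
  · exact h i hi

open scoped Classical in
theorem card_not_boundedPeriodic_le (n t : ℕ) :
    (((words n).filter fun x => x ∉ boundedPeriodic n 2 t).card : ℝ) * 2 ^ (t + 1) ≤
      n * (2 ^ n * 4) := by
  set Q : List Bool → Prop := fun u => ∀ i, i + 2 < u.length → u[i]? = u[i + 2]? with hQ
  set F : ℕ → Finset (List Bool) := fun i =>
    (words n).filter fun x => Q ((x.drop i).take (t + 1)) with hF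
  have hsub : ((words n).filter fun x => x ∉ boundedPeriodic n 2 t) ⊆
      ((Finset.range n).filter fun i => i + (t + 1) ≤ n).biUnion F := by
    intro x hx
    obtain ⟨hx, hb⟩ := Finset.mem_filter.1 hx
    have hxl := mem_words.1 hx
    -- A violating substring is cut down to its first `t + 1` entries, which are still invariant
    -- under the shift by two.
    have : ∃ u, List.IsInfix u x ∧ (∃ p ≤ 2, HasPeriod u p) ∧ t < u.length := by
      by_contra! hcon
      exact hb ⟨hxl, fun u h1 h2 => hcon u h1 h2⟩
    obtain ⟨u, ⟨s, r, hsr⟩, ⟨p, hp, hper⟩, hu⟩ := this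
    have hlen : s.length + u.length + r.length = n := by
      rw [← hxl, ← hsr]; simp [add_assoc]
    refine Finset.mem_biUnion.2 ⟨s.length, ?_, Finset.mem_filter.2 ⟨hx, ?_⟩⟩
    · simp only [Finset.mem_filter, Finset.mem_range]; omega
    · have hsu := shift_two_of_hasPeriod hp hper
      have hd : (x.drop s.length).take (t + 1) = u.take (t + 1) := by
        rw [← hsr, List.append_assoc, List.drop_left, List.take_append_of_le_length (by omega)]
      rw [hd]
      intro i hi
      have hi : i + 2 < t + 1 := by simp at hi; omega
      rw [List.getElem?_take, List.getElem?_take, if_pos (by omega), if_pos hi]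
      exact hsu i (by omega)
  have hFle : ∀ i ∈ (Finset.range n).filter fun i => i + (t + 1) ≤ n,
      ((F i).card : ℝ) ≤ 2 ^ n * 4 / 2 ^ (t + 1) := by
    intro i hi
    have hi := (Finset.mem_filter.1 hi).2
    have h4 : (((words (t + 1)).filter Q).card : ℝ) ≤ 4 := by
      exact_mod_cast card_period_two_le (t + 1)
    rw [le_div_iff₀ (by positivity)]
    calc ((F i).card : ℝ) * 2 ^ (t + 1) ≤ (2 ^ (n - (t + 1)) * 4) * 2 ^ (t + 1) := by
          gcongr
          exact (card_filter_window_le Q hi).trans (by gcongr)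
      _ = 2 ^ (n - (t + 1) + (t + 1)) * 4 := by rw [pow_add]; ring
      _ = 2 ^ n * 4 := by rw [Nat.sub_add_cancel (by omega)]
  rw [← le_div_iff₀ (by positivity)]
  calc (((words n).filter fun x => x ∉ boundedPeriodic n 2 t).card : ℝ)
      ≤ ((((Finset.range n).filter fun i => i + (t + 1) ≤ n).biUnion F).card : ℝ) := by
        exact_mod_cast Finset.card_le_card hsub
    _ ≤ ∑ i ∈ (Finset.range n).filter (fun i => i + (t + 1) ≤ n), ((F i).card : ℝ) := by
        exact_mod_cast Finset.card_biUnion_le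
    _ ≤ ((Finset.range n).filter fun i => i + (t + 1) ≤ n).card • (2 ^ n * 4 / 2 ^ (t + 1) : ℝ) :=
        Finset.sum_le_card_nsmul _ _ _ hFle
    _ ≤ n * (2 ^ n * 4 / 2 ^ (t + 1)) := by
        rw [nsmul_eq_mul]
        gcongr
        exact (Finset.card_filter_le _ _).trans (by simp)
    _ = n * (2 ^ n * 4) / 2 ^ (t + 1) := by ring

/-- Since `1296 = 4 * 324` and 324 factors of the rate already bring it below `1/2`, the window
length yields `n ^ (-4)`, enough to beat the quadratic number of windows. -/
theorem rate_pow_winLen_le {n : ℕ} (hn : 10 ≤ n) :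
    (994 / 1000 : ℝ) ^ winLen n ≤ 1 / (n : ℝ) ^ 4 := by
  have hn0 : (0 : ℝ) < n := by exact_mod_cast (by omega : 0 < n)
  have h1 : 1296 * Real.logb 2 (n : ℝ) ≤ winLen n := Nat.le_ceil _
  have h2 : (994 / 1000 : ℝ) ^ (324 : ℕ) ≤ 1 / 2 := by
    have : (994 / 1000 : ℝ) ^ (162 : ℕ) ≤ 1 / 2 := by norm_num
    calc (994 / 1000 : ℝ) ^ (324 : ℕ) ≤ (994 / 1000 : ℝ) ^ (162 : ℕ) :=
          pow_le_pow_of_le_one (by norm_num) (by norm_num) (by norm_num)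
      _ ≤ 1 / 2 := this
  have h3 : 0 ≤ Real.logb 2 (n : ℝ) := by have := three_le_logb hn; linarith
  calc (994 / 1000 : ℝ) ^ winLen n = (994 / 1000 : ℝ) ^ (winLen n : ℝ) := (Real.rpow_natCast _ _).symm
    _ ≤ (994 / 1000 : ℝ) ^ (((324 : ℕ) : ℝ) * (4 * Real.logb 2 (n : ℝ))) :=
        Real.rpow_le_rpow_of_exponent_ge (by norm_num) (by norm_num) (by push_cast; linarith)
    _ = ((994 / 1000 : ℝ) ^ (324 : ℕ)) ^ (4 * Real.logb 2 (n : ℝ)) := by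
        rw [Real.rpow_mul (by norm_num), Real.rpow_natCast]
    _ ≤ (1 / 2 : ℝ) ^ (4 * Real.logb 2 (n : ℝ)) :=
        Real.rpow_le_rpow (by positivity) h2 (by linarith)
    _ = 1 / (n : ℝ) ^ 4 := by
        rw [one_div, Real.inv_rpow (by norm_num), mul_comm, Real.rpow_mul (by norm_num),
          Real.rpow_logb (by norm_num) (by norm_num) hn0, one_div]
        norm_cast

open scoped Classical in
/-- At least half of all words satisfy the constraints that do not involve residues. -/
theorem half_le_card {n : ℕ} (hn : 10 ≤ n) :
    (2 : ℝ) ^ n / 2 ≤ ((words n).filter fun x => x ∈ balancedSet n ∧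
      x ∈ boundedPeriodic n 2 (⌈Real.logb 2 (n : ℝ)⌉₊ + 3)).card := by
  set t := ⌈Real.logb 2 (n : ℝ)⌉₊ + 3 with ht
  set G := (words n).filter fun x => x ∈ balancedSet n ∧ x ∈ boundedPeriodic n 2 t with hG
  have hn0 : (10 : ℝ) ≤ n := by exact_mod_cast hn
  have b1 := card_not_balanced_le n (winLen n)
  have b2 := card_not_balanced_diffSeq_le n (winLen n)
  have b3 := card_not_boundedPeriodic_le n t
  set B1 := (words n).filter fun x => ¬ StrongLocallyBalanced (winLen n) (1 / 18) x with hB1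
  set B2 := (words n).filter fun x => ¬ StrongLocallyBalanced (winLen n) (1 / 18) (diffSeq x)
    with hB2
  set B3 := (words n).filter fun x => x ∉ boundedPeriodic n 2 t with hB3
  have hcov : words n ⊆ G ∪ (B1 ∪ (B2 ∪ B3)) := by
    intro x hx
    have hxl := mem_words.1 hx
    have hbal : x ∈ balancedSet n ↔ x.length = n ∧ StrongLocallyBalanced (winLen n) (1 / 18) x ∧
      StrongLocallyBalanced (winLen n) (1 / 18) (diffSeq x) := Iff.rfl
    simp only [hG, hB1, hB2, hB3, Finset.mem_union, Finset.mem_filter, hx, true_and, hbal]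
    tauto
  have hcard : (2 : ℝ) ^ n ≤ G.card + (B1.card + (B2.card + B3.card)) := by
    rw [← card_words]
    have h1 := Finset.card_union_le B2 B3
    have h2 := Finset.card_union_le B1 (B2 ∪ B3)
    have h3 := Finset.card_union_le G (B1 ∪ (B2 ∪ B3))
    have h4 := Finset.card_le_card hcov
    exact_mod_cast (by omega : (words n).card ≤ G.card + (B1.card + (B2.card + B3.card)))
  have hr := rate_pow_winLen_le hn
  have hr' : ((n : ℝ) + 2) ^ 2 * (994 / 1000 : ℝ) ^ winLen n ≤ 36 / 25 / 100 := by
    calc ((n : ℝ) + 2) ^ 2 * (994 / 1000 : ℝ) ^ winLen n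
        ≤ (6 / 5 * n) ^ 2 * (1 / (n : ℝ) ^ 4) := by
          gcongr
          linarith
      _ = 36 / 25 / (n : ℝ) ^ 2 := by field_simp; norm_num
      _ ≤ 36 / 25 / 100 := by
          gcongr
          nlinarith
  have e12 : (B1.card : ℝ) + B2.card ≤ 2 ^ n * (6 * (36 / 25 / 100)) := by
    have hle : ((n : ℝ) + 1) ^ 2 ≤ ((n : ℝ) + 2) ^ 2 := by gcongr; norm_num
    have c1 : (B1.card : ℝ) ≤ 2 ^ n * (2 * (((n : ℝ) + 2) ^ 2 * (994 / 1000 : ℝ) ^ winLen n)) := by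
      refine b1.trans ?_
      calc ((n : ℝ) + 1) ^ 2 * (2 ^ n * (2 * (994 / 1000) ^ winLen n))
          ≤ ((n : ℝ) + 2) ^ 2 * (2 ^ n * (2 * (994 / 1000) ^ winLen n)) := by gcongr
        _ = _ := by ring
    have c2 : (B2.card : ℝ) ≤ 2 ^ n * (4 * (((n : ℝ) + 2) ^ 2 * (994 / 1000 : ℝ) ^ winLen n)) := by
      refine b2.trans (le_of_eq ?_)
      push_cast
      ring
    have c3 : (2 : ℝ) ^ n * (6 * (((n : ℝ) + 2) ^ 2 * (994 / 1000 : ℝ) ^ winLen n)) ≤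
        2 ^ n * (6 * (36 / 25 / 100)) := by gcongr
    linarith
  -- The summand 3 in `t` gives `2 ^ (t + 1) ≥ 16 * n`, against `4 * n` from the union bound.
  have e3 : (B3.card : ℝ) ≤ 2 ^ n / 4 := by
    have hpow : (16 * n : ℝ) ≤ 2 ^ (t + 1) := by
      have h1 : (n : ℝ) ≤ 2 ^ ⌈Real.logb 2 (n : ℝ)⌉₊ := by
        rw [← Real.rpow_natCast, ← Real.logb_le_iff_le_rpow (by norm_num) (by linarith)]
        exact Nat.le_ceil _
      rw [ht, show ⌈Real.logb 2 (n : ℝ)⌉₊ + 3 + 1 = ⌈Real.logb 2 (n : ℝ)⌉₊ + 4 by ring, pow_add]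
      linarith
    have h2 : (B3.card : ℝ) * (16 * n) ≤ n * (2 ^ n * 4) :=
      le_trans (by gcongr) b3
    nlinarith
  have hp : (0 : ℝ) < 2 ^ n := by positivity
  linarith

/-! ### The pigeonhole principle over the residues -/

/-- The moduli of the block constraints. -/
noncomputable def blockMod (n : ℕ) (k : Fin 3) : ℕ := 3 * (2 * blockLen n) ^ (k.val + 1)

theorem blockMod_pos {n : ℕ} (hn : 10 ≤ n) (k : Fin 3) : 0 < blockMod n k := by
  have := le_winLen hn
  have : 0 < blockLen n := by unfold blockLen; omega
  unfold blockMod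
  positivity

/-- The tuples of residues. -/
abbrev Residues (n : ℕ) : Type :=
  Fin 4 × Fin (3 * n + 1) × Fin 7 × Fin (6 * (n + 1) + 1) ×
    ((k : Fin 3) → Fin (blockMod n k)) × ((k : Fin 3) → Fin (blockMod n k))

/-- The residues of a word. -/
noncomputable def residues {n : ℕ} (hn : 10 ≤ n) (x : List Bool) : Residues n :=
  (⟨VT 0 x % 4, Nat.mod_lt _ (by norm_num)⟩, ⟨VT 1 x % (3 * n + 1), Nat.mod_lt _ (by omega)⟩,
    ⟨VT 0 (diffSeq x) % 7, Nat.mod_lt _ (by norm_num)⟩,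
    ⟨VT 1 (diffSeq x) % (6 * (n + 1) + 1), Nat.mod_lt _ (by omega)⟩,
    fun k => ⟨oddPairVT (blockLen n) (k.val + 1) x % blockMod n k, Nat.mod_lt _ (blockMod_pos hn k)⟩,
    fun k => ⟨evenPairVT (blockLen n) (k.val + 1) x % blockMod n k,
      Nat.mod_lt _ (blockMod_pos hn k)⟩)

/-- The parameters given by a tuple of residues. -/
def Residues.toParams {n : ℕ} (r : Residues n) : Params :=
  ⟨r.1, r.2.1, r.2.2.1, r.2.2.2.1, fun k => r.2.2.2.2.1 k, fun k => r.2.2.2.2.2 k⟩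

theorem Residues.inRange {n : ℕ} (r : Residues n) : r.toParams.InRange n :=
  ⟨Nat.le_of_lt_succ r.1.2, Nat.le_of_lt_succ r.2.1.2, Nat.le_of_lt_succ r.2.2.1.2,
    Nat.le_of_lt_succ r.2.2.2.1.2, fun k => ⟨(r.2.2.2.2.1 k).2, (r.2.2.2.2.2 k).2⟩⟩

theorem mem_code_residues {n : ℕ} (hn : 10 ≤ n) {x : List Bool} (h1 : x ∈ balancedSet n)
    (h2 : x ∈ boundedPeriodic n 2 (⌈Real.logb 2 (n : ℝ)⌉₊ + 3)) :
    x ∈ code n (Residues.toParams (residues hn x)) :=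
  ⟨h1, h2, (Nat.mod_modEq _ _).symm, (Nat.mod_modEq _ _).symm, (Nat.mod_modEq _ _).symm,
    (Nat.mod_modEq _ _).symm, fun _ => ⟨(Nat.mod_modEq _ _).symm, (Nat.mod_modEq _ _).symm⟩⟩

/-- The exponent 6 is `1 + 2 + 3`, and the square accounts for the two families of block pairs;
together they produce the power 12 of the logarithm. -/
theorem card_residues (n : ℕ) : Fintype.card (Residues n) =
    4 * ((3 * n + 1) * (7 * ((6 * (n + 1) + 1) * (27 * (2 * blockLen n) ^ 6) ^ 2))) := by
  have hpi : Fintype.card ((k : Fin 3) → Fin (blockMod n k)) = 27 * (2 * blockLen n) ^ 6 := by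
    rw [Fintype.card_pi, Fin.prod_univ_three, Fintype.card_fin, Fintype.card_fin,
      Fintype.card_fin]
    simp only [blockMod, Fin.val_zero, Fin.val_one, Fin.val_two]
    ring
  rw [Fintype.card_prod, Fintype.card_prod, Fintype.card_prod, Fintype.card_prod,
    Fintype.card_prod, hpi, Fintype.card_fin, Fintype.card_fin, Fintype.card_fin, Fintype.card_fin]
  ring

theorem blockLen_le {n : ℕ} (hn : 10 ≤ n) :
    (2 * blockLen n : ℝ) ≤ 10376 * Real.logb 2 (n : ℝ) := by
  have h1 := three_le_logb hn
  have h2 : (winLen n : ℝ) < 1296 * Real.logb 2 (n : ℝ) + 1 := Nat.ceil_lt_add_one (by linarith)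
  unfold blockLen
  push_cast
  linarith

theorem card_residues_le {n : ℕ} (hn : 10 ≤ n) : (Fintype.card (Residues n) : ℝ) ≤
    784 * 27 ^ 2 * 10376 ^ 12 * ((n : ℝ) ^ 2 * Real.logb 2 (n : ℝ) ^ 12) := by
  have hn0 : (10 : ℝ) ≤ n := by exact_mod_cast hn
  have hB := blockLen_le hn
  rw [card_residues]
  push_cast
  calc (4 * ((3 * n + 1) * (7 * ((6 * (n + 1) + 1) * (27 * (2 * blockLen n) ^ 6) ^ 2))) : ℝ)
      ≤ 4 * ((4 * n) * (7 * ((7 * n) * (27 * (10376 * Real.logb 2 (n : ℝ)) ^ 6) ^ 2))) := by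
        gcongr <;> linarith
    _ = _ := by ring

theorem code_finite (n : ℕ) (p : Params) : (code n p).Finite :=
  (List.finite_length_eq Bool n).subset fun _ hx => hx.1.1

/-- The codes for all residue tuples cover the at least `2 ^ n / 2` words of `half_le_card`, so one
of them is at least as large as the average. -/
theorem exists_large_code {n : ℕ} (hn : 10 ≤ n) : ∃ p : Params, p.InRange n ∧
    (2 : ℝ) ^ n / 2 / Fintype.card (Residues n) ≤ (code n p).ncard := by
  classical
  set G := (words n).filter fun x => x ∈ balancedSet n ∧
    x ∈ boundedPeriodic n 2 (⌈Real.logb 2 (n : ℝ)⌉₊ + 3) with hG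
  have : Nonempty (Residues n) := ⟨residues hn []⟩
  obtain ⟨r, -, hr⟩ := Finset.exists_le_card_fiber_of_nsmul_le_card_of_maps_to
    (s := G) (t := (Finset.univ : Finset (Residues n))) (f := residues hn)
    (b := (2 : ℝ) ^ n / 2 / Fintype.card (Residues n)) (fun _ _ => Finset.mem_univ _)
    Finset.univ_nonempty (by
      rw [nsmul_eq_mul, Finset.card_univ, mul_div_cancel₀]
      · exact half_le_card hn
      · exact_mod_cast Fintype.card_ne_zero)
  refine ⟨Residues.toParams r, r.inRange, hr.trans ?_⟩
  rw [← Set.ncard_coe_finset]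
  refine Nat.cast_le.2 (Set.ncard_le_ncard (fun x hx => ?_) (code_finite n _))
  obtain ⟨hx, hxr⟩ := Finset.mem_filter.1 (Finset.mem_coe.1 hx)
  obtain ⟨_, h1, h2⟩ := Finset.mem_filter.1 hx
  rw [← hxr]
  exact mem_code_residues hn h1 h2

theorem redundancy_le_of_card {n : ℕ} {C : Set (List Bool)} {M : ℝ} (hM : 0 < M)
    (h : (2 : ℝ) ^ n / 2 / M ≤ C.ncard) : redundancy n C ≤ 1 + Real.logb 2 M := by
  have hp : (0 : ℝ) < 2 ^ n / 2 / M := by positivity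
  have h1 := Real.logb_le_logb_of_le (by norm_num : (1 : ℝ) < 2) hp h
  rw [Real.logb_div (by positivity) hM.ne', Real.logb_div (by positivity) (by norm_num),
    Real.logb_pow, Real.logb_self_eq_one (by norm_num)] at h1
  unfold redundancy
  linarith

end DelSub

theorem theorem7 :
    (∀ n : ℕ, 10 ≤ n → ∀ p : DelSub.Params, p.InRange n →
      DelSub.IsReconstructionCode n 9 (DelSub.code n p)) ∧
    ∃ K : ℝ, ∀ n : ℕ, 10 ≤ n → ∃ p : DelSub.Params, p.InRange n ∧
      (DelSub.code n p).Nonempty ∧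
      DelSub.redundancy n (DelSub.code n p) ≤
        2 * Real.logb 2 (n : ℝ) + 12 * Real.logb 2 (Real.logb 2 (n : ℝ)) + K := by
  refine ⟨fun n hn p _ => DelSub.isReconstructionCode_code hn p,
    1 + Real.logb 2 (784 * 27 ^ 2 * 10376 ^ 12), fun n hn => ?_⟩
  obtain ⟨p, hp, hcard⟩ := DelSub.exists_large_code hn
  have hn0 : (0 : ℝ) < n := by exact_mod_cast (by omega : 0 < n)
  have hlog : 0 < Real.logb 2 (n : ℝ) := by have := DelSub.three_le_logb hn; linarith
  have hM : (0 : ℝ) < Fintype.card (DelSub.Residues n) := by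
    have : Nonempty (DelSub.Residues n) := ⟨DelSub.residues hn []⟩
    exact_mod_cast Fintype.card_pos
  refine ⟨p, hp, ?_, ?_⟩
  · have : (0 : ℝ) < (DelSub.code n p).ncard := lt_of_lt_of_le (by positivity) hcard
    exact Set.nonempty_of_ncard_ne_zero (by exact_mod_cast this.ne')
  · have h1 := DelSub.redundancy_le_of_card hM hcard
    have h2 := Real.logb_le_logb_of_le (by norm_num : (1 : ℝ) < 2) hM (DelSub.card_residues_le hn)
    have h3 : ∀ c : ℝ, 0 < c → Real.logb 2 (c * ((n : ℝ) ^ 2 * Real.logb 2 (n : ℝ) ^ 12)) =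
        Real.logb 2 c + (2 * Real.logb 2 (n : ℝ) + 12 * Real.logb 2 (Real.logb 2 (n : ℝ))) := by
      intro c hc
      rw [Real.logb_mul (by positivity) (by positivity), Real.logb_mul (by positivity)
        (by positivity), Real.logb_pow, Real.logb_pow]
      norm_num
    rw [h3 _ (by positivity)] at h2
    linarith
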